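/- Let $N\ge 1$ be an integer, $s\in(0,1)$ and $q\in(1,2)$. For a function $u$ on $\mathbb R^N$ put $$[u]^2=\int_{\mathbb R^N}\int_{\mathbb R^N}\frac{(u(x)-u(y))^2}{|x-y|^{N+2s}}\,dx\,dy .$$ For an open set $\Omega\subset\mathbb R^N$ let $$\lambda_1(\Omega,s,2)=\inf\Big\{[\varphi]^2:\ \varphi\in C_0^\infty(\Omega),\ \int_\Omega|\varphi|^2\,dx=1\Big\}\in[0,\infty],$$ with the convention $\inf\emptyset=+\infty$. For a bounded open set $U\subset\mathbb R^N$ let $\mathcal D^{s,2}_0(U)$ be the completion of $C_0^\infty(U)$ with respect to the norm $[\,\cdot\,]$ (a space of functions, extended by zero outside $U$), and let $w_{U,s,q}$ be the minimiser (unique up to null sets) of $$\varphi\mapsto \frac12[\varphi]^2-\frac1q\int_U\varphi^q\,dx$$ among all $\varphi\in\mathcal D^{s,2}_0(U)$ with $\varphi\ge0$ a.e. in $U$. For an arbitrary open set $\Omega\subset\mathbb R^N$ let the $(s,q)$-Lane--Emden density $w_{\Omega,s,q}\colon\Omega\to[0,\infty]$ be defined by $$w_{\Omega,s,q}(x)=\lim_{r\to\infty}w_{\Omega\cap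 B_r,s,q}(x)\qquad\text{for a.e. }x\in\Omega,$$ where $B_r$ is the ball of radius $r$ centred at the origin. Then the following hold. 1. There is a constant $C>0$, depending only on $N$, $s$ and $q$, such that for every open set $\Omega\subset\mathbb R^N$ with $\lambda_1(\Omega,s,2)>0$ one has $w_{\Omega,s,q}\in L^\infty(\Omega)$ and $$\|w_{\Omega,s,q}\|_{L^\infty(\Omega)}^{2-q}\le C\,\lambda_1(\Omega,s,2)^{-1}.$$ 2. Conversely, for every open set $\Omega\subset\mathbb R^N$ with $w_{\Omega,s,q}\in L^\infty(\Omega)$ one has $$\lambda_1(\Omega,s,2)\ge\|w_{\Omega,s,q}\|_{L^\infty(\Omega)}^{q-2}.$$ (For $\Omega=\emptyset$ the conventions $0^{q-2}=+\infty$ and $(+\infty)^{-1}=0$ are used.) -/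

import Mathlib

open MeasureTheory Filter Topology Metric
open scoped ENNReal NNReal ContDiff

namespace FracLaneEmden

/-- Membership in `C₀^∞(Ω)`: smooth functions whose support is a compact subset of `Ω`. -/
def IsTestFunction {N : ℕ} (Ω : Set (EuclideanSpace ℝ (Fin N)))
    (φ : EuclideanSpace ℝ (Fin N) → ℝ) : Prop :=
  ContDiff ℝ ∞ φ ∧ HasCompactSupport φ ∧ tsupport φ ⊆ Ω

/-- The double integral `∫∫ (u(x) - u(y))² / |x - y|^(N + 2s) dx dy` over `ℝ^N × ℝ^N`,
with values in `[0, ∞]`. -/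
noncomputable def energy {N : ℕ} (s : ℝ) (u : EuclideanSpace ℝ (Fin N) → ℝ) : ℝ≥0∞ :=
  ∫⁻ x, ∫⁻ y, ENNReal.ofReal ((u x - u y) ^ 2 / ‖x - y‖ ^ ((N : ℝ) + 2 * s))

/-- The first `q`-semilinear `s`-eigenvalue `λ₁(Ω, s, q)`, as an infimum in `[0, ∞]`
(so that it is `∞` for the empty set). -/
noncomputable def firstEigenvalue {N : ℕ} (Ω : Set (EuclideanSpace ℝ (Fin N))) (s q : ℝ) :
    ℝ≥0∞ :=
  ⨅ (φ : EuclideanSpace ℝ (Fin N) → ℝ) (_ : IsTestFunction Ω φ)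
    (_ : ∫ x in Ω, |φ x| ^ q = 1), energy s φ

/-- Membership in `𝓓₀^{s,2}(U)`, the completion of `C₀^∞(U)` for the square root of `energy s`,
realised as a space of functions on `ℝ^N` (vanishing a.e. outside `U`): the element represented
by a Cauchy sequence of test functions is its limit `u`, the sequence being chosen (up to a
subsequence) so that it also converges to `u` almost everywhere. This is the completion whenever
the latter embeds in some `L^p(U)`, in particular for every bounded open `U`. -/
def MemD {N : ℕ} (U : Set (EuclideanSpace ℝ (Fin N))) (s : ℝ)
    (u : EuclideanSpace ℝ (Fin N) → ℝ) : Prop :=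
  ∃ φ : ℕ → EuclideanSpace ℝ (Fin N) → ℝ,
    (∀ n, IsTestFunction U (φ n)) ∧
    (∀ᵐ x, Tendsto (fun n => φ n x) atTop (𝓝 (u x))) ∧
    Tendsto (fun n => energy s (φ n - u)) atTop (𝓝 0)

/-- The free energy `½ ∫∫ (u(x) - u(y))² / |x - y|^(N + 2s) dx dy - (1/q) ∫_U u^q dx`
of a non-negative `u ∈ 𝓓₀^{s,2}(U)` (both terms are finite if `U` is bounded and `1 < q < 2`). -/
noncomputable def freeEnergy {N : ℕ} (U : Set (EuclideanSpace ℝ (Fin N))) (s q : ℝ)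
    (u : EuclideanSpace ℝ (Fin N) → ℝ) : ℝ :=
  1 / 2 * (energy s u).toReal - 1 / q * ∫ x in U, u x ^ q

/-- `u` is (a representative of) the Lane-Emden density of a bounded open set `U`: it minimises
the free energy among the functions of `𝓓₀^{s,2}(U)` that are non-negative a.e. in `U`. -/
def IsBoundedDensity {N : ℕ} (U : Set (EuclideanSpace ℝ (Fin N))) (s q : ℝ)
    (u : EuclideanSpace ℝ (Fin N) → ℝ) : Prop :=
  (MemD U s u ∧ ∀ᵐ x ∂(volume.restrict U), 0 ≤ u x) ∧
  ∀ v : EuclideanSpace ℝ (Fin N) → ℝ,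
    MemD U s v → (∀ᵐ x ∂(volume.restrict U), 0 ≤ v x) → freeEnergy U s q u ≤ freeEnergy U s q v

/-- `w : ℝ^N → [0, ∞]` is (a representative of) the Lane-Emden density `w_{Ω,s,q}` of an
arbitrary open set `Ω`: a.e. in `Ω` it is the limit, as `r → ∞`, of the Lane-Emden densities of
the bounded sets `Ω ∩ B_r`. Its values outside `Ω` are irrelevant. -/
def IsLaneEmdenDensity {N : ℕ} (Ω : Set (EuclideanSpace ℝ (Fin N))) (s q : ℝ)
    (w : EuclideanSpace ℝ (Fin N) → ℝ≥0∞) : Prop :=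
  ∃ v : ℝ → EuclideanSpace ℝ (Fin N) → ℝ,
    (∀ r, 0 < r → IsBoundedDensity (Ω ∩ ball 0 r) s q (v r)) ∧
    ∀ᵐ x ∂(volume.restrict Ω),
      Tendsto (fun r => ENNReal.ofReal (v r x)) atTop (𝓝 (w x))

end FracLaneEmden

/-!
For the upper bound, let `u` be the density of a bounded set and put `K = ‖u‖_∞ / 4`. Around any
point take a smooth barrier `H` with `1 ≤ H ≤ 4`, equal to `1` on `B_{R/2}`, to `4` outside `B_R`,
and with `|D^s H|² ≲ R^{-2s} ≈ K^{q-2}`. Since `u ≤ 4K`, the function `(u - KH)₊` lives in `B_R`,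
and minimality of `u` bounds its energy by `K^{q-2} ∫_{u > KH} u²`. If `λ₁` is a large multiple of
`K^{q-2}`, the Poincaré inequality makes the `L²` norm of `(u - KH)₊` so small that a De Giorgi
iteration over the levels from `K` to `2K` gives `u ≤ 2K` on `B_{R/2}`. As the centre was arbitrary,
this contradicts `‖u‖_∞ = 4K`, so `λ₁ ≲ ‖u‖_∞^{q-2}`.

For the lower bound, compare `u` with `v = √(u² + ε²φ²)`. The energy is convex along this
interpolation, `[v]² ≤ [u]² + ε²[φ]²`, and `t ↦ t^{q/2}` is concave, so minimality of `u` yields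
`∫ φ² v^{q-2} ≤ [φ]²`. Letting `ε → 0` and the ball grow gives `∫ φ² w^{q-2} ≤ [φ]²`, where
`w^{q-2} ≥ ‖w‖_∞^{q-2}`.
-/

namespace FracLaneEmden

variable {N : ℕ} {s q : ℝ} {U V : Set (EuclideanSpace ℝ (Fin N))}
  {u v φ : EuclideanSpace ℝ (Fin N) → ℝ}

/-! ### The fractional gradient -/

/-- The singular measure `|x - y|^(-N-2s) dx dy` on `ℝ^N × ℝ^N`, with respect to which `energy s u`
is the integral of `(u x - u y)²`. -/
noncomputable def gagliardoMeasure (N : ℕ) (s : ℝ) :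
    Measure (EuclideanSpace ℝ (Fin N) × EuclideanSpace ℝ (Fin N)) :=
  (volume.prod volume).withDensity fun p => ENNReal.ofReal (‖p.1 - p.2‖ ^ ((N : ℝ) + 2 * s))⁻¹

/-- The squared fractional gradient `|D^s u|²(x) = ∫ (u(x) - u(y))² / |x - y|^(N + 2s) dy`, the
inner integral of `energy s u`. -/
noncomputable def fracGradSq (s : ℝ) (u : EuclideanSpace ℝ (Fin N) → ℝ)
    (x : EuclideanSpace ℝ (Fin N)) : ℝ≥0∞ :=
  ∫⁻ y, ENNReal.ofReal ((u x - u y) ^ 2 / ‖x - y‖ ^ ((N : ℝ) + 2 * s))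

theorem lintegral_fracGradSq : ∫⁻ x, fracGradSq s u x = energy s u := rfl

theorem energy_congr_ae (h : u =ᵐ[volume] v) : energy s u = energy s v := by
  refine lintegral_congr_ae ?_
  filter_upwards [h] with x hx
  refine lintegral_congr_ae ?_
  filter_upwards [h] with y hy
  rw [hx, hy]

theorem fracGradSq_const_mul (c : ℝ) (x : EuclideanSpace ℝ (Fin N)) :
    fracGradSq s (fun y => c * u y) x = ENNReal.ofReal (c ^ 2) * fracGradSq s u x := by
  rw [fracGradSq, fracGradSq, ← lintegral_const_mul' _ _ (by finiteness)]
  refine lintegral_congr fun y => ?_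
  rw [← ENNReal.ofReal_mul (by positivity)]
  congr 1
  ring

theorem fracGradSq_const_sub (c : ℝ) (x : EuclideanSpace ℝ (Fin N)) :
    fracGradSq s (fun y => c - u y) x = fracGradSq s u x := by
  refine lintegral_congr fun y => ?_
  congr 2
  ring

theorem energy_const_mul (c : ℝ) :
    energy s (fun x => c * u x) = ENNReal.ofReal (c ^ 2) * energy s u := by
  rw [← lintegral_fracGradSq, ← lintegral_fracGradSq, ← lintegral_const_mul' _ _ (by finiteness)]
  exact lintegral_congr fun x => fracGradSq_const_mul c x

theorem energy_sub_comm : energy s (u - v) = energy s (v - u) := by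
  refine lintegral_congr fun x => lintegral_congr fun y => ?_
  congr 2
  simp only [Pi.sub_apply]
  ring

theorem gagliardoMeasure_absolutelyContinuous :
    gagliardoMeasure N s ≪ volume.prod volume :=
  withDensity_absolutelyContinuous _ _

theorem quasiMeasurePreserving_fst_gagliardoMeasure :
    Measure.QuasiMeasurePreserving Prod.fst (gagliardoMeasure N s) volume :=
  Measure.quasiMeasurePreserving_fst.mono_left gagliardoMeasure_absolutelyContinuous

theorem quasiMeasurePreserving_snd_gagliardoMeasure :
    Measure.QuasiMeasurePreserving Prod.snd (gagliardoMeasure N s) volume :=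
  Measure.quasiMeasurePreserving_snd.mono_left gagliardoMeasure_absolutelyContinuous

theorem ae_gagliardoMeasure_of_ae {P : EuclideanSpace ℝ (Fin N) → Prop} (h : ∀ᵐ x, P x) :
    ∀ᵐ p ∂gagliardoMeasure N s, P p.1 ∧ P p.2 :=
  (quasiMeasurePreserving_fst_gagliardoMeasure.ae h).and
    (quasiMeasurePreserving_snd_gagliardoMeasure.ae h)

theorem aemeasurable_sub_gagliardoMeasure (hu : AEMeasurable u) :
    AEMeasurable (fun p => u p.1 - u p.2) (gagliardoMeasure N s) :=
  (hu.comp_quasiMeasurePreserving quasiMeasurePreserving_fst_gagliardoMeasure).sub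
    (hu.comp_quasiMeasurePreserving quasiMeasurePreserving_snd_gagliardoMeasure)

theorem measurable_gagliardoKernel :
    Measurable fun p : EuclideanSpace ℝ (Fin N) × EuclideanSpace ℝ (Fin N) =>
      ENNReal.ofReal (‖p.1 - p.2‖ ^ ((N : ℝ) + 2 * s))⁻¹ := by
  fun_prop

theorem lintegral_gagliardoMeasure (hu : AEMeasurable u) :
    ∫⁻ p, ENNReal.ofReal ((u p.1 - u p.2) ^ 2) ∂gagliardoMeasure N s = energy s u := by
  have hF : AEMeasurable (fun p : EuclideanSpace ℝ (Fin N) × EuclideanSpace ℝ (Fin N) =>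
      ENNReal.ofReal ((u p.1 - u p.2) ^ 2)) (volume.prod volume) :=
    ((hu.comp_fst.sub hu.comp_snd).pow_const 2).ennreal_ofReal
  rw [gagliardoMeasure, lintegral_withDensity_eq_lintegral_mul₀
    measurable_gagliardoKernel.aemeasurable hF,
    lintegral_prod _ (measurable_gagliardoKernel.aemeasurable.mul hF)]
  refine lintegral_congr fun x => lintegral_congr fun y => ?_
  rw [Pi.mul_apply, ← ENNReal.ofReal_mul (by positivity), div_eq_inv_mul]

theorem setLIntegral_fst_gagliardoMeasure (hu : Measurable u) {A : Set (EuclideanSpace ℝ (Fin N))}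
    (hA : MeasurableSet A) :
    ∫⁻ p in Prod.fst ⁻¹' A, ENNReal.ofReal ((u p.1 - u p.2) ^ 2) ∂gagliardoMeasure N s =
      ∫⁻ x in A, fracGradSq s u x := by
  rw [gagliardoMeasure, setLIntegral_withDensity_eq_setLIntegral_mul _ measurable_gagliardoKernel
    (by fun_prop) (measurable_fst hA), ← Set.prod_univ,
    setLIntegral_prod _ (Measurable.aemeasurable (by fun_prop)), Measure.restrict_univ]
  refine lintegral_congr fun x => lintegral_congr fun y => ?_
  rw [Pi.mul_apply, ← ENNReal.ofReal_mul (by positivity), div_eq_inv_mul]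

theorem setLIntegral_snd_gagliardoMeasure (hu : Measurable u) {A : Set (EuclideanSpace ℝ (Fin N))}
    (hA : MeasurableSet A) :
    ∫⁻ p in Prod.snd ⁻¹' A, ENNReal.ofReal ((u p.1 - u p.2) ^ 2) ∂gagliardoMeasure N s =
      ∫⁻ x in A, fracGradSq s u x := by
  rw [gagliardoMeasure, setLIntegral_withDensity_eq_setLIntegral_mul _ measurable_gagliardoKernel
    (by fun_prop) (measurable_snd hA), ← Set.univ_prod,
    setLIntegral_prod_symm _ (Measurable.aemeasurable (by fun_prop)), Measure.restrict_univ]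
  refine lintegral_congr fun y => lintegral_congr fun x => ?_
  rw [Pi.mul_apply, ← ENNReal.ofReal_mul (by positivity), div_eq_inv_mul, norm_sub_rev,
    sub_sq_comm]

theorem setLIntegral_gagliardoMeasure_le (hu : Measurable u) {Γ : ℝ≥0∞}
    (hΓ : ∀ x, fracGradSq s u x ≤ Γ) {A : Set (EuclideanSpace ℝ (Fin N))} (hA : MeasurableSet A) :
    ∫⁻ p in Prod.fst ⁻¹' A ∪ Prod.snd ⁻¹' A, ENNReal.ofReal ((u p.1 - u p.2) ^ 2)
      ∂gagliardoMeasure N s ≤ 2 * Γ * volume A := by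
  have hle : ∫⁻ x in A, fracGradSq s u x ≤ Γ * volume A :=
    (lintegral_mono hΓ).trans_eq (setLIntegral_const A Γ)
  refine (lintegral_union_le _ _ _).trans ?_
  rw [setLIntegral_fst_gagliardoMeasure hu hA, setLIntegral_snd_gagliardoMeasure hu hA, mul_assoc,
    two_mul]
  exact add_le_add hle hle

/-- The kernel `min(1, |z|²) |z|^(-N-2s)` is integrable at the origin since `s < 1` and at infinity
since `0 < s`. -/
theorem lintegral_min_one_sq_div_rpow_lt_top [NeZero N] (hs : s ∈ Set.Ioo (0 : ℝ) 1) :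
    ∫⁻ z : EuclideanSpace ℝ (Fin N),
      ENNReal.ofReal (min 1 (‖z‖ ^ 2) / ‖z‖ ^ ((N : ℝ) + 2 * s)) < ⊤ := by
  obtain ⟨hs0, hs1⟩ := hs
  refine ((integrable_fun_norm_addHaar (volume : Measure (EuclideanSpace ℝ (Fin N)))
    (f := fun r : ℝ => min 1 (r ^ 2) / r ^ ((N : ℝ) + 2 * s))).2 ?_).lintegral_lt_top
  simp only [finrank_euclideanSpace, Fintype.card_fin, smul_eq_mul]
  have hpow (r : ℝ) : r ^ (N - 1) = r ^ ((N : ℝ) - 1) := by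
    rw [← Real.rpow_natCast, Nat.cast_sub NeZero.one_le, Nat.cast_one]
  rw [← Set.Ioo_union_Ici_eq_Ioi zero_lt_one, integrableOn_union,
    integrableOn_Ici_iff_integrableOn_Ioi]
  constructor
  · refine ((intervalIntegral.integrableOn_Ioo_rpow_iff (s := 1 - 2 * s)
      zero_lt_one).2 (by linarith)).congr_fun (fun r hr => ?_) measurableSet_Ioo
    have h0 : 0 < r := hr.1
    beta_reduce
    rw [min_eq_right (by nlinarith [hr.1, hr.2]), hpow r, ← Real.rpow_natCast r 2,
      ← Real.rpow_sub h0, ← Real.rpow_add h0]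
    congr 1
    push_cast
    ring
  · refine (integrableOn_Ioi_rpow_of_lt (a := -1 - 2 * s) (by linarith)
      zero_lt_one).congr_fun (fun r hr => ?_) measurableSet_Ioi
    have h1 : 1 < r := hr
    have h0 : 0 < r := by linarith
    beta_reduce
    rw [min_eq_left (by nlinarith), hpow r, one_div, ← Real.rpow_neg h0.le, ← Real.rpow_add h0]
    congr 1
    ring

theorem fracGradSq_le_of_sq_sub_le {c : ℝ} (hc : 0 ≤ c)
    (hu : ∀ x y, (u x - u y) ^ 2 ≤ c * min 1 (‖x - y‖ ^ 2)) (x : EuclideanSpace ℝ (Fin N)) :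
    fracGradSq s u x ≤ ENNReal.ofReal c * ∫⁻ z : EuclideanSpace ℝ (Fin N),
      ENNReal.ofReal (min 1 (‖z‖ ^ 2) / ‖z‖ ^ ((N : ℝ) + 2 * s)) := by
  rw [← lintegral_const_mul' _ _ ENNReal.ofReal_ne_top, ← lintegral_sub_left_eq_self _ x]
  refine lintegral_mono fun y => ?_
  rw [← ENNReal.ofReal_mul hc, ← mul_div_assoc]
  exact ENNReal.ofReal_le_ofReal (div_le_div_of_nonneg_right (hu x y) (by positivity))

theorem lintegral_comp_inv_smul {r : ℝ} (hr : 0 < r) (f : EuclideanSpace ℝ (Fin N) → ℝ≥0∞) :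
    ∫⁻ z, f (r⁻¹ • z) = ENNReal.ofReal (r ^ N) * ∫⁻ z, f z := by
  have hmap := Measure.map_addHaar_smul (volume : Measure (EuclideanSpace ℝ (Fin N)))
    (inv_pos.2 hr).ne'
  rw [finrank_euclideanSpace_fin, inv_pow, inv_inv, abs_of_pos (by positivity)] at hmap
  rw [← smul_eq_mul, ← lintegral_smul_measure, ← hmap]
  exact (lintegral_map_equiv f
    (Homeomorph.smulOfNeZero r⁻¹ (inv_pos.2 hr).ne').toMeasurableEquiv).symm

theorem fracGradSq_comp_inv_smul_sub {R : ℝ} (hR : 0 < R) (x₀ x : EuclideanSpace ℝ (Fin N)) :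
    fracGradSq s (fun y => u (R⁻¹ • (y - x₀))) x =
      ENNReal.ofReal (R ^ (-(2 * s))) * fracGradSq s u (R⁻¹ • (x - x₀)) := by
  set f : EuclideanSpace ℝ (Fin N) → ℝ≥0∞ := fun z =>
    ENNReal.ofReal ((u (R⁻¹ • (x - x₀)) - u z) ^ 2 /
      ‖R⁻¹ • (x - x₀) - z‖ ^ ((N : ℝ) + 2 * s)) with hf
  have hscale (y : EuclideanSpace ℝ (Fin N)) :
      ENNReal.ofReal ((u (R⁻¹ • (x - x₀)) - u (R⁻¹ • (y - x₀))) ^ 2 /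
        ‖x - y‖ ^ ((N : ℝ) + 2 * s)) =
        ENNReal.ofReal (R ^ (-((N : ℝ) + 2 * s))) * f (R⁻¹ • (y - x₀)) := by
    have hnorm : ‖R⁻¹ • (x - x₀) - R⁻¹ • (y - x₀)‖ = R⁻¹ * ‖x - y‖ := by
      rw [← smul_sub, sub_sub_sub_cancel_right, norm_smul, norm_inv, Real.norm_of_nonneg hR.le]
    rw [hf, ← ENNReal.ofReal_mul (by positivity), hnorm,
      Real.mul_rpow (by positivity) (norm_nonneg _), Real.inv_rpow hR.le, Real.rpow_neg hR.le]
    congr 1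
    field_simp
  calc fracGradSq s (fun y => u (R⁻¹ • (y - x₀))) x
      = ENNReal.ofReal (R ^ (-((N : ℝ) + 2 * s))) * ∫⁻ y, f (R⁻¹ • (y - x₀)) := by
        rw [← lintegral_const_mul' _ _ ENNReal.ofReal_ne_top]
        exact lintegral_congr hscale
    _ = ENNReal.ofReal (R ^ (-((N : ℝ) + 2 * s))) * (ENNReal.ofReal (R ^ N) * ∫⁻ z, f z) := by
        rw [lintegral_sub_right_eq_self (fun y => f (R⁻¹ • y)), lintegral_comp_inv_smul hR]
    _ = _ := by
        rw [← mul_assoc, ← ENNReal.ofReal_mul (by positivity), ← Real.rpow_natCast,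
          ← Real.rpow_add hR, neg_add_rev, neg_add_cancel_right]
        rfl

/-! ### Test functions and the energy space -/

theorem isTestFunction_of_support_subset (hφ : ContDiff ℝ ∞ φ) {K : Set (EuclideanSpace ℝ (Fin N))}
    (hK : IsCompact K) (hsupp : Function.support φ ⊆ K) (hKU : K ⊆ U) : IsTestFunction U φ :=
  ⟨hφ, .of_support_subset_isCompact hK hsupp, (closure_minimal hsupp hK.isClosed).trans hKU⟩

namespace IsTestFunction

theorem continuous (h : IsTestFunction U φ) : Continuous φ := h.1.continuous

theorem measurable (h : IsTestFunction U φ) : Measurable φ := h.continuous.measurable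

theorem isCompact_tsupport (h : IsTestFunction U φ) : IsCompact (tsupport φ) := h.2.1.isCompact

theorem eq_zero (h : IsTestFunction U φ) {x : EuclideanSpace ℝ (Fin N)} (hx : x ∉ U) : φ x = 0 :=
  image_eq_zero_of_notMem_tsupport fun hx' => hx (h.2.2 hx')

theorem mono (h : IsTestFunction U φ) (hUV : U ⊆ V) : IsTestFunction V φ :=
  ⟨h.1, h.2.1, h.2.2.trans hUV⟩

theorem sub {ψ : EuclideanSpace ℝ (Fin N) → ℝ} (h : IsTestFunction U φ) (h' : IsTestFunction U ψ) :
    IsTestFunction U (φ - ψ) :=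
  ⟨h.1.sub h'.1, h.2.1.sub h'.2.1, (tsupport_sub _ _).trans (Set.union_subset h.2.2 h'.2.2)⟩

theorem const_mul (h : IsTestFunction U φ) (c : ℝ) : IsTestFunction U fun x => c * φ x :=
  ⟨contDiff_const.mul h.1, h.2.1.mul_left, tsupport_mul_subset_right.trans h.2.2⟩

theorem exists_sq_sub_le (h : IsTestFunction U φ) :
    ∃ c, 0 < c ∧ ∀ x y, (φ x - φ y) ^ 2 ≤ c * min 1 (‖x - y‖ ^ 2) := by
  obtain ⟨B, hB⟩ := h.2.1.exists_bound_of_continuous h.continuous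
  obtain ⟨L, hL⟩ := ContDiff.lipschitzWith_of_hasCompactSupport h.2.1 h.1 (by simp)
  refine ⟨(2 * B) ^ 2 + (L : ℝ) ^ 2 + 1, by positivity, fun x y => ?_⟩
  have hbdd : |φ x - φ y| ≤ 2 * B := by
    rw [two_mul]
    exact (abs_sub _ _).trans (add_le_add (hB x) (hB y))
  have hlip : |φ x - φ y| ≤ L * ‖x - y‖ := by
    simpa only [dist_eq_norm] using! hL.dist_le_mul x y
  have hsq_bdd := pow_le_pow_left₀ (abs_nonneg _) hbdd 2
  have hsq_lip := pow_le_pow_left₀ (abs_nonneg _) hlip 2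
  rw [sq_abs] at hsq_bdd hsq_lip
  rcases min_cases (1 : ℝ) (‖x - y‖ ^ 2) with ⟨hmin, _⟩ | ⟨hmin, _⟩ <;> rw [hmin]
  · linarith [sq_nonneg (L : ℝ)]
  · calc (φ x - φ y) ^ 2 ≤ (L : ℝ) ^ 2 * ‖x - y‖ ^ 2 := by rwa [mul_pow] at hsq_lip
      _ ≤ ((2 * B) ^ 2 + (L : ℝ) ^ 2 + 1) * ‖x - y‖ ^ 2 := by gcongr; linarith [sq_nonneg (2 * B)]

theorem exists_fracGradSq_le [NeZero N] (hs : s ∈ Set.Ioo (0 : ℝ) 1) (h : IsTestFunction U φ) :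
    ∃ Γ : ℝ, 0 < Γ ∧ ∀ x, fracGradSq s φ x ≤ ENNReal.ofReal Γ := by
  obtain ⟨c, hc, hφ⟩ := h.exists_sq_sub_le
  have hkernel := lintegral_min_one_sq_div_rpow_lt_top (N := N) hs
  set K := ∫⁻ z : EuclideanSpace ℝ (Fin N),
    ENNReal.ofReal (min 1 (‖z‖ ^ 2) / ‖z‖ ^ ((N : ℝ) + 2 * s))
  refine ⟨c * (K.toReal + 1), by positivity, fun x => ?_⟩
  refine (fracGradSq_le_of_sq_sub_le hc.le hφ x).trans ?_
  rw [ENNReal.ofReal_mul hc.le]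
  gcongr
  exact (ENNReal.le_ofReal_iff_toReal_le hkernel.ne (by positivity)).2 (by linarith)

theorem energy_lt_top [NeZero N] (hs : s ∈ Set.Ioo (0 : ℝ) 1) (h : IsTestFunction U φ) :
    energy s φ < ⊤ := by
  obtain ⟨Γ, -, hΓ⟩ := h.exists_fracGradSq_le hs
  have hcompact := h.isCompact_tsupport
  have hzero : ∀ p ∉ (Prod.fst ⁻¹' tsupport φ ∪ Prod.snd ⁻¹' tsupport φ),
      ENNReal.ofReal ((φ p.1 - φ p.2) ^ 2) = 0 := fun p hp => by
    simp only [Set.mem_union, Set.mem_preimage, not_or] at hp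
    simp [image_eq_zero_of_notMem_tsupport hp.1, image_eq_zero_of_notMem_tsupport hp.2]
  rw [← lintegral_gagliardoMeasure h.measurable.aemeasurable,
    ← setLIntegral_eq_of_support_subset fun p hp => not_imp_comm.1 (hzero p) hp]
  refine (setLIntegral_gagliardoMeasure_le h.measurable hΓ
    hcompact.isClosed.measurableSet).trans_lt ?_
  have := hcompact.measure_lt_top (μ := volume)
  finiteness

end IsTestFunction

theorem ofReal_sq_le_of_abs_le_add {a b c : ℝ} (h : |c| ≤ |a| + |b|) :
    ENNReal.ofReal (c ^ 2) ≤ 2 * ENNReal.ofReal (a ^ 2) + 2 * ENNReal.ofReal (b ^ 2) := by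
  rw [← ENNReal.ofReal_ofNat, ← ENNReal.ofReal_mul (by norm_num),
    ← ENNReal.ofReal_mul (by norm_num), ← ENNReal.ofReal_add (by positivity) (by positivity)]
  refine ENNReal.ofReal_le_ofReal ?_
  rw [← sq_abs a, ← sq_abs b, ← sq_abs c, ← mul_add]
  exact (pow_le_pow_left₀ (abs_nonneg c) h 2).trans (add_sq_le (a := |a|) (b := |b|))

theorem energy_sub_le (hu : AEMeasurable u) (hv : AEMeasurable v) :
    energy s (u - v) ≤ 2 * energy s u + 2 * energy s v := by
  rw [← lintegral_gagliardoMeasure hu, ← lintegral_gagliardoMeasure hv,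
    ← lintegral_gagliardoMeasure (hu.sub hv), ← lintegral_const_mul' _ _ (by simp),
    ← lintegral_const_mul' _ _ (by simp), ← lintegral_add_left'
      (((aemeasurable_sub_gagliardoMeasure hu).pow_const 2).ennreal_ofReal.const_mul 2)]
  refine lintegral_mono fun p => ofReal_sq_le_of_abs_le_add ?_
  rw [Pi.sub_apply, Pi.sub_apply, sub_sub_sub_comm]
  exact abs_sub _ _

namespace MemD

theorem aemeasurable (h : MemD U s u) : AEMeasurable u := by
  obtain ⟨φ, hφ, hlim, -⟩ := h
  exact aemeasurable_of_tendsto_metrizable_ae atTop (fun n => (hφ n).measurable.aemeasurable) hlim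

theorem ae_eq_zero (h : MemD U s u) : ∀ᵐ x, x ∉ U → u x = 0 := by
  obtain ⟨φ, hφ, hlim, -⟩ := h
  filter_upwards [hlim] with x hx hxU
  refine tendsto_nhds_unique hx ?_
  simp only [(hφ _).eq_zero hxU, tendsto_const_nhds]

theorem congr_ae (h : MemD U s u) (huv : u =ᵐ[volume] v) : MemD U s v := by
  obtain ⟨φ, hφ, hlim, hE⟩ := h
  refine ⟨φ, hφ, ?_, hE.congr fun n => energy_congr_ae (huv.mono fun x hx => ?_)⟩
  · filter_upwards [hlim, huv] with x hx hx'
    rwa [← hx']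
  · simp only [Pi.sub_apply, hx]

theorem energy_lt_top [NeZero N] (hs : s ∈ Set.Ioo (0 : ℝ) 1) (h : MemD U s u) :
    energy s u < ⊤ := by
  have hu := h.aemeasurable
  obtain ⟨φ, hφ, -, hE⟩ := h
  obtain ⟨n, hn⟩ := ((tendsto_order.1 hE).2 1 one_pos).exists
  have hfin := (hφ n).energy_lt_top hs
  have hm := (hφ n).measurable.aemeasurable (μ := volume)
  calc energy s u = energy s (φ n - (φ n - u)) := by rw [sub_sub_cancel]
    _ ≤ 2 * energy s (φ n) + 2 * energy s (φ n - u) := energy_sub_le hm (hm.sub hu)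
    _ < ⊤ := by finiteness

theorem sub (hu : MemD U s u) (hv : MemD U s v) : MemD U s (u - v) := by
  have hum := hu.aemeasurable
  have hvm := hv.aemeasurable
  obtain ⟨φ, hφ, hφl, hφE⟩ := hu
  obtain ⟨ψ, hψ, hψl, hψE⟩ := hv
  refine ⟨fun n => φ n - ψ n, fun n => (hφ n).sub (hψ n), ?_, ?_⟩
  · filter_upwards [hφl, hψl] with x h1 h2 using h1.sub h2
  · have hlim : Tendsto (fun n => 2 * energy s (φ n - u) + 2 * energy s (ψ n - v)) atTop (𝓝 0) := by
      simpa using (ENNReal.Tendsto.const_mul (a := 2) hφE (by simp)).add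
        (ENNReal.Tendsto.const_mul (a := 2) hψE (by simp))
    refine tendsto_of_tendsto_of_tendsto_of_le_of_le tendsto_const_nhds hlim
      (fun _ => zero_le) fun n => ?_
    rw [sub_sub_sub_comm]
    exact energy_sub_le ((hφ n).measurable.aemeasurable.sub hum)
      ((hψ n).measurable.aemeasurable.sub hvm)

end MemD

theorem tendsto_lintegral_zero_of_le_add {α : Type*} [MeasurableSpace α] {μ : Measure α}
    {F A : ℕ → α → ℝ≥0∞} {G : α → ℝ≥0∞} (hF : ∀ n, AEMeasurable (F n) μ) (hG : AEMeasurable G μ)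
    (hGfin : ∫⁻ x, G x ∂μ ≠ ⊤) (hle : ∀ n, ∀ᵐ x ∂μ, F n x ≤ A n x + G x)
    (hFlim : ∀ᵐ x ∂μ, Tendsto (fun n => F n x) atTop (𝓝 0))
    (hAlim : Tendsto (fun n => ∫⁻ x, A n x ∂μ) atTop (𝓝 0)) :
    Tendsto (fun n => ∫⁻ x, F n x ∂μ) atTop (𝓝 0) := by
  have hmin : Tendsto (fun n => ∫⁻ x, min (F n x) (G x) ∂μ) atTop (𝓝 0) := by
    simpa using tendsto_lintegral_of_dominated_convergence' (f := fun _ => 0) G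
      (fun n => (hF n).min hG) (fun n => .of_forall fun x => min_le_right _ _) hGfin
      (hFlim.mono fun x hx => by simpa using hx.min (tendsto_const_nhds (x := G x)))
  refine tendsto_of_tendsto_of_tendsto_of_le_of_le tendsto_const_nhds
    (by simpa using hAlim.add hmin) (fun _ => zero_le) fun n => ?_
  rw [← lintegral_add_right' _ ((hF n).min hG)]
  refine lintegral_mono_ae ?_
  filter_upwards [hle n] with x hx
  rcases le_total (F n x) (G x) with h | h
  · rw [min_eq_left h]
    exact le_add_self
  · rwa [min_eq_right h]

theorem ofReal_sq_sub_le_of_dominated {a b c d : ℝ} {g : ℝ≥0∞}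
    (ha : ENNReal.ofReal (a ^ 2) ≤ 2 * ENNReal.ofReal (c ^ 2) + g)
    (hb : ENNReal.ofReal (b ^ 2) ≤ 2 * ENNReal.ofReal (d ^ 2) + g) :
    ENNReal.ofReal ((a - b) ^ 2) ≤
      8 * ENNReal.ofReal ((c - d) ^ 2) + (12 * ENNReal.ofReal (d ^ 2) + 4 * g) := by
  have hc : ENNReal.ofReal (c ^ 2) ≤
      2 * ENNReal.ofReal ((c - d) ^ 2) + 2 * ENNReal.ofReal (d ^ 2) :=
    ofReal_sq_le_of_abs_le_add (by simpa only [sub_add_cancel] using abs_add_le (c - d) d)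
  calc ENNReal.ofReal ((a - b) ^ 2)
      ≤ 2 * ENNReal.ofReal (a ^ 2) + 2 * ENNReal.ofReal (b ^ 2) :=
        ofReal_sq_le_of_abs_le_add (abs_sub a b)
    _ ≤ 2 * (2 * (2 * ENNReal.ofReal ((c - d) ^ 2) + 2 * ENNReal.ofReal (d ^ 2)) + g) +
        2 * (2 * ENNReal.ofReal (d ^ 2) + g) := by
        gcongr
        exact ha.trans (by gcongr)
    _ = _ := by ring

/-- The energies of `ψ n - f` are controlled by those of `φ n - u` plus a fixed integrable function,
so they tend to zero by dominated convergence. -/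
theorem memD_of_dominated [NeZero N] (hs : s ∈ Set.Ioo (0 : ℝ) 1)
    {φ ψ : ℕ → EuclideanSpace ℝ (Fin N) → ℝ} (hφ : ∀ n, IsTestFunction U (φ n))
    (hφl : ∀ᵐ x, Tendsto (fun n => φ n x) atTop (𝓝 (u x)))
    (hφE : Tendsto (fun n => energy s (φ n - u)) atTop (𝓝 0)) (hψ : ∀ n, IsTestFunction U (ψ n))
    (hψl : ∀ᵐ x, Tendsto (fun n => ψ n x) atTop (𝓝 (v x)))
    {G : EuclideanSpace ℝ (Fin N) × EuclideanSpace ℝ (Fin N) → ℝ≥0∞} (hG : Measurable G)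
    (hGfin : ∫⁻ p, G p ∂gagliardoMeasure N s ≠ ⊤)
    (hdom : ∀ n p, ENNReal.ofReal ((ψ n p.1 - ψ n p.2) ^ 2) ≤
      2 * ENNReal.ofReal ((φ n p.1 - φ n p.2) ^ 2) + G p) : MemD U s v := by
  have huD : MemD U s u := ⟨φ, hφ, hφl, hφE⟩
  have hum := huD.aemeasurable
  have hvm : AEMeasurable v :=
    aemeasurable_of_tendsto_metrizable_ae atTop (fun n => (hψ n).measurable.aemeasurable) hψl
  have hφm n := (hφ n).measurable.aemeasurable (μ := volume)
  have hψm n := (hψ n).measurable.aemeasurable (μ := volume)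
  have hΔu := (aemeasurable_sub_gagliardoMeasure (s := s) hum).pow_const 2 |>.ennreal_ofReal
  refine ⟨ψ, hψ, hψl, ?_⟩
  simp_rw [← lintegral_gagliardoMeasure ((hψm _).sub hvm)]
  simp_rw [← lintegral_gagliardoMeasure ((hφm _).sub hum)] at hφE
  refine tendsto_lintegral_zero_of_le_add
    (A := fun n p => 8 * ENNReal.ofReal (((φ n - u) p.1 - (φ n - u) p.2) ^ 2))
    (G := fun p => 12 * ENNReal.ofReal ((u p.1 - u p.2) ^ 2) + 4 * G p)
    (fun n => ((aemeasurable_sub_gagliardoMeasure ((hψm n).sub hvm)).pow_const 2).ennreal_ofReal)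
    ((hΔu.const_mul 12).add (hG.const_mul 4).aemeasurable) ?_ (fun n => ?_) ?_ ?_
  · rw [lintegral_add_left' (hΔu.const_mul 12), lintegral_const_mul' _ _ (by simp),
      lintegral_const_mul' _ _ (by simp), lintegral_gagliardoMeasure hum]
    have := huD.energy_lt_top hs
    finiteness
  · filter_upwards [ae_gagliardoMeasure_of_ae hφl, ae_gagliardoMeasure_of_ae hψl] with p hφp hψp
    have hv : ENNReal.ofReal ((v p.1 - v p.2) ^ 2) ≤
        2 * ENNReal.ofReal ((u p.1 - u p.2) ^ 2) + G p :=
      le_of_tendsto_of_tendsto' (ENNReal.tendsto_ofReal ((hψp.1.sub hψp.2).pow 2))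
        ((ENNReal.Tendsto.const_mul (ENNReal.tendsto_ofReal ((hφp.1.sub hφp.2).pow 2))
          (by simp)).add_const _) fun n => hdom n p
    simp only [Pi.sub_apply]
    rw [sub_sub_sub_comm (ψ n p.1), sub_sub_sub_comm (φ n p.1)]
    exact ofReal_sq_sub_le_of_dominated (hdom n p) hv
  · filter_upwards [ae_gagliardoMeasure_of_ae hψl] with p hp
    simpa using ENNReal.tendsto_ofReal
      (((hp.1.sub_const (v p.1)).sub (hp.2.sub_const (v p.2))).pow 2)
  · simp_rw [lintegral_const_mul' (8 : ℝ≥0∞) _ (by simp)]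
    simpa using ENNReal.Tendsto.const_mul (a := 8) hφE (by simp)

theorem sq_sqrt_sub_sqrt_le (e a b c d : ℝ) :
    (√(e ^ 2 + a ^ 2 + c ^ 2) - √(e ^ 2 + b ^ 2 + d ^ 2)) ^ 2 ≤ (a - b) ^ 2 + (c - d) ^ 2 := by
  have h := abs_norm_sub_norm_le !₂[e, a, c] !₂[e, b, d]
  simp only [EuclideanSpace.norm_eq, Fin.sum_univ_three, PiLp.sub_apply, Real.norm_eq_abs,
    sq_abs, Matrix.cons_val, sub_self, zero_pow two_ne_zero, zero_add] at h
  rw [← sq_abs]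
  exact (Real.le_sqrt (abs_nonneg _) (by positivity)).1 h

theorem IsTestFunction.sqrt_sq_add_sq_sub {ψ : EuclideanSpace ℝ (Fin N) → ℝ}
    (hφ : IsTestFunction U φ) (hψ : IsTestFunction U ψ) {e : ℝ} (he : 0 < e) :
    IsTestFunction U fun x => √(e ^ 2 + φ x ^ 2 + ψ x ^ 2) - e := by
  refine isTestFunction_of_support_subset ?_ (hφ.isCompact_tsupport.union hψ.isCompact_tsupport)
    (fun x => not_imp_comm.1 fun hx => ?_) (Set.union_subset hφ.2.2 hψ.2.2)
  · exact (((contDiff_const.add (hφ.1.pow 2)).add (hψ.1.pow 2)).sqrt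
      fun x => by positivity).sub contDiff_const
  · rw [Set.mem_union, not_or] at hx
    simp [image_eq_zero_of_notMem_tsupport hx.1, image_eq_zero_of_notMem_tsupport hx.2,
      Real.sqrt_sq he.le]

theorem MemD.sqrt_sq_add_sq [NeZero N] (hs : s ∈ Set.Ioo (0 : ℝ) 1) (hu : MemD U s u)
    (hφ : IsTestFunction U φ) : MemD U s fun x => √(u x ^ 2 + φ x ^ 2) := by
  obtain ⟨ψ, hψ, hψl, hψE⟩ := hu
  have hlim : Tendsto (fun n : ℕ => 1 / ((n : ℝ) + 1)) atTop (𝓝 0) :=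
    tendsto_one_div_add_atTop_nhds_zero_nat
  have hφm := hφ.measurable
  refine memD_of_dominated hs hψ hψl hψE
    (fun n => (hψ n).sqrt_sq_add_sq_sub hφ (e := 1 / ((n : ℝ) + 1)) (by positivity)) ?_
    (G := fun p => ENNReal.ofReal ((φ p.1 - φ p.2) ^ 2)) (by fun_prop) ?_ fun n p => ?_
  · filter_upwards [hψl] with x hx
    simpa using ((((hlim.pow 2).add (hx.pow 2)).add_const (φ x ^ 2)).sqrt).sub hlim
  · rw [lintegral_gagliardoMeasure hφm.aemeasurable]
    exact (hφ.energy_lt_top hs).ne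
  · rw [sub_sub_sub_cancel_right]
    calc _ ≤ ENNReal.ofReal ((ψ n p.1 - ψ n p.2) ^ 2 + (φ p.1 - φ p.2) ^ 2) :=
          ENNReal.ofReal_le_ofReal (sq_sqrt_sub_sqrt_le _ _ _ _ _)
      _ ≤ ENNReal.ofReal ((ψ n p.1 - ψ n p.2) ^ 2) + ENNReal.ofReal ((φ p.1 - φ p.2) ^ 2) :=
          ENNReal.ofReal_add_le
      _ ≤ _ := by
          gcongr
          exact le_mul_of_one_le_left' one_le_two

/-- A smooth approximation of the positive part, vanishing on `(-∞, 0]` and of slope `1` on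
`[ε, ∞)`. -/
noncomputable def smoothRamp (ε t : ℝ) : ℝ := ∫ x in (0 : ℝ)..t, Real.smoothTransition (x / ε)

section smoothRamp

variable {ε t : ℝ}

theorem continuous_smoothTransition_div : Continuous fun x : ℝ => Real.smoothTransition (x / ε) :=
  Real.smoothTransition.continuous.comp (continuous_id.div_const ε)

theorem contDiff_smoothRamp : ContDiff ℝ ∞ (smoothRamp ε) := by
  have hderiv (t : ℝ) : HasDerivAt (smoothRamp ε) (Real.smoothTransition (t / ε)) t :=
    continuous_smoothTransition_div.integral_hasStrictDerivAt 0 t |>.hasDerivAt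
  rw [contDiff_infty_iff_deriv, funext fun t => (hderiv t).deriv]
  exact ⟨fun t => (hderiv t).differentiableAt,
    Real.smoothTransition.contDiff.comp (contDiff_id.div_const ε)⟩

theorem smoothRamp_of_nonpos (hε : 0 < ε) (ht : t ≤ 0) : smoothRamp ε t = 0 := by
  rw [smoothRamp, intervalIntegral.integral_congr (g := fun _ => 0),
    intervalIntegral.integral_zero]
  intro x hx
  rw [Set.uIcc_of_ge ht] at hx
  exact Real.smoothTransition.zero_of_nonpos (div_nonpos_of_nonpos_of_nonneg hx.2 hε.le)

theorem smoothRamp_sub (a b : ℝ) :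
    smoothRamp ε a - smoothRamp ε b = ∫ x in b..a, Real.smoothTransition (x / ε) :=
  intervalIntegral.integral_interval_sub_left
    (continuous_smoothTransition_div.intervalIntegrable _ _)
    (continuous_smoothTransition_div.intervalIntegrable _ _)

theorem abs_smoothRamp_sub_le (a b : ℝ) : |smoothRamp ε a - smoothRamp ε b| ≤ |a - b| := by
  rw [smoothRamp_sub]
  simpa using! intervalIntegral.norm_integral_le_of_norm_le_const (a := b) (b := a) (C := 1)
    fun x _ => by
      rw [Real.norm_of_nonneg (Real.smoothTransition.nonneg (x / ε))]
      exact Real.smoothTransition.le_one _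

theorem abs_smoothRamp_sub_max_le (hε : 0 < ε) : |smoothRamp ε t - max t 0| ≤ ε := by
  have hzero : smoothRamp ε 0 = 0 := smoothRamp_of_nonpos hε le_rfl
  rcases le_total t 0 with ht | ht
  · simpa [smoothRamp_of_nonpos hε ht, max_eq_right ht] using hε.le
  rw [max_eq_left ht]
  have hnonneg {a : ℝ} (ha : 0 ≤ a) : 0 ≤ smoothRamp ε a :=
    intervalIntegral.integral_nonneg ha fun x _ => Real.smoothTransition.nonneg _
  have hle : smoothRamp ε t ≤ t := by
    have := abs_smoothRamp_sub_le (ε := ε) t 0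
    rw [hzero, sub_zero, sub_zero, abs_of_nonneg ht] at this
    exact (le_abs_self _).trans this
  have hge : t - ε ≤ smoothRamp ε t := by
    rcases le_total t ε with htε | htε
    · linarith [hnonneg ht]
    · have hslope : smoothRamp ε t - smoothRamp ε ε = t - ε := by
        rw [smoothRamp_sub, intervalIntegral.integral_congr (g := fun _ => 1),
          intervalIntegral.integral_const, smul_eq_mul, mul_one]
        intro x hx
        rw [Set.uIcc_of_le htε] at hx
        exact Real.smoothTransition.one_of_one_le ((one_le_div hε).2 hx.1)
      linarith [hnonneg hε.le]
  exact abs_le.2 ⟨by linarith, by linarith⟩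

theorem tendsto_smoothRamp {ε a : ℕ → ℝ} (hε : ∀ n, 0 < ε n) (hεlim : Tendsto ε atTop (𝓝 0))
    (ha : Tendsto a atTop (𝓝 t)) :
    Tendsto (fun n => smoothRamp (ε n) (a n)) atTop (𝓝 (max t 0)) := by
  have hdiff : Tendsto (fun n => smoothRamp (ε n) (a n) - max (a n) 0) atTop (𝓝 0) :=
    squeeze_zero_norm (fun n => abs_smoothRamp_sub_max_le (hε n)) hεlim
  simpa using hdiff.add (ha.max (tendsto_const_nhds (x := (0 : ℝ))))

end smoothRamp

theorem IsTestFunction.smoothRamp_sub {h : EuclideanSpace ℝ (Fin N) → ℝ}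
    (hφ : IsTestFunction U φ) (hh : ContDiff ℝ ∞ h) (h0 : ∀ x, 0 ≤ h x) {ε : ℝ} (hε : 0 < ε) :
    IsTestFunction U fun x => smoothRamp ε (φ x - h x) := by
  refine isTestFunction_of_support_subset (contDiff_smoothRamp.comp (hφ.1.sub hh))
    hφ.isCompact_tsupport (fun x => not_imp_comm.1 fun hx => ?_) hφ.2.2
  beta_reduce
  rw [image_eq_zero_of_notMem_tsupport hx, smoothRamp_of_nonpos hε (by linarith [h0 x])]

theorem MemD.posPart_sub [NeZero N] (hs : s ∈ Set.Ioo (0 : ℝ) 1) (hU : MeasurableSet U)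
    (hUfin : volume U ≠ ⊤) {h : EuclideanSpace ℝ (Fin N) → ℝ} (hu : MemD U s u)
    (hh : ContDiff ℝ ∞ h) (h0 : ∀ x, 0 ≤ h x) {Γ : ℝ≥0∞} (hΓfin : Γ ≠ ⊤)
    (hΓ : ∀ x, fracGradSq s h x ≤ Γ) : MemD U s fun x => max (u x - h x) 0 := by
  obtain ⟨φ, hφ, hφl, hφE⟩ := hu
  have hhm := hh.continuous.measurable
  have hε (n : ℕ) : (0 : ℝ) < 1 / ((n : ℝ) + 1) := by positivity
  set D := Prod.fst ⁻¹' U ∪ Prod.snd ⁻¹' U with hD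
  have hDm : MeasurableSet D := (measurable_fst hU).union (measurable_snd hU)
  have hΔh : Measurable fun p : EuclideanSpace ℝ (Fin N) × EuclideanSpace ℝ (Fin N) =>
      2 * ENNReal.ofReal ((h p.1 - h p.2) ^ 2) := by fun_prop
  refine memD_of_dominated hs hφ hφl hφE (fun n => (hφ n).smoothRamp_sub hh h0 (hε n)) ?_
    (hΔh.indicator hDm) ?_ fun n p => ?_
  · filter_upwards [hφl] with x hx
    exact tendsto_smoothRamp hε tendsto_one_div_add_atTop_nhds_zero_nat (hx.sub_const _)
  · rw [lintegral_indicator hDm, lintegral_const_mul' _ _ (by simp)]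
    have := setLIntegral_gagliardoMeasure_le hhm hΓ hU
    exact ENNReal.mul_ne_top (by simp) (ne_top_of_le_ne_top (by finiteness) this)
  · by_cases hp : p ∈ D
    · rw [Set.indicator_of_mem hp]
      refine ofReal_sq_le_of_abs_le_add ((abs_smoothRamp_sub_le _ _).trans ?_)
      rw [sub_sub_sub_comm]
      exact abs_sub _ _
    · rw [Set.indicator_of_notMem hp]
      simp only [hD, Set.mem_union, Set.mem_preimage, not_or] at hp
      rw [(hφ n).eq_zero hp.1, (hφ n).eq_zero hp.2,
        smoothRamp_of_nonpos (hε n) (by linarith [h0 p.1]),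
        smoothRamp_of_nonpos (hε n) (by linarith [h0 p.2])]
      simp

theorem IsBoundedDensity.congr_ae (h : IsBoundedDensity U s q u) (huv : u =ᵐ[volume] v) :
    IsBoundedDensity U s q v := by
  obtain ⟨⟨hD, h0⟩, hmin⟩ := h
  have huvU := ae_restrict_of_ae (s := U) huv
  refine ⟨⟨hD.congr_ae huv, ?_⟩, fun w hw hw0 => le_of_eq_of_le ?_ (hmin w hw hw0)⟩
  · filter_upwards [h0, huvU] with x hx huvx
    rwa [← huvx]
  · have hint : ∫ x in U, u x ^ q = ∫ x in U, v x ^ q := by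
      refine integral_congr_ae ?_
      filter_upwards [huvU] with x hx
      rw [hx]
    rw [freeEnergy, freeEnergy, energy_congr_ae huv, hint]

/-- A Lane-Emden density of a bounded set, normalised on null sets: Borel, everywhere non-negative,
and zero everywhere outside the set. -/
structure IsBorelDensity (U : Set (EuclideanSpace ℝ (Fin N))) (s q : ℝ)
    (u : EuclideanSpace ℝ (Fin N) → ℝ) : Prop where
  isBoundedDensity : IsBoundedDensity U s q u
  measurable : Measurable u
  nonneg (x : EuclideanSpace ℝ (Fin N)) : 0 ≤ u x
  eq_zero {x : EuclideanSpace ℝ (Fin N)} (hx : x ∉ U) : u x = 0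

theorem IsBorelDensity.memD (hu : IsBorelDensity U s q u) : MemD U s u := hu.isBoundedDensity.1.1

theorem IsBoundedDensity.exists_isBorelDensity (hU : MeasurableSet U)
    (h : IsBoundedDensity U s q u) : ∃ v, u =ᵐ[volume] v ∧ IsBorelDensity U s q v := by
  have hm := h.1.1.aemeasurable
  have hae : u =ᵐ[volume] U.indicator fun x => max (hm.mk u x) 0 := by
    filter_upwards [hm.ae_eq_mk, (ae_restrict_iff' hU).1 h.1.2, h.1.1.ae_eq_zero] with x hmk h0 hU0
    by_cases hx : x ∈ U
    · rw [Set.indicator_of_mem hx, ← hmk, max_eq_left (h0 hx)]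
    · rw [Set.indicator_of_notMem hx, hU0 hx]
  exact ⟨_, hae, h.congr_ae hae, (hm.measurable_mk.max measurable_const).indicator hU,
    Set.indicator_nonneg fun _ _ => le_max_right _ _, fun hx => Set.indicator_of_notMem hx _⟩

/-! ### Gagliardo inequalities -/

theorem rpow_sub_rpow_le_mul_sq_sub_sq {a b : ℝ} (hq0 : 0 ≤ q) (hq2 : q ≤ 2) (ha : 0 < a)
    (hb : 0 ≤ b) : b ^ q - a ^ q ≤ q / 2 * a ^ (q - 2) * (b ^ 2 - a ^ 2) := by
  have hbernoulli := rpow_one_add_le_one_add_mul_self (s := (b / a) ^ 2 - 1) (p := q / 2)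
    (by linarith [sq_nonneg (b / a)]) (by linarith) (by linarith)
  have hpow : ((b / a) ^ 2) ^ (q / 2) = b ^ q / a ^ q := by
    rw [← Real.rpow_natCast, ← Real.rpow_mul (by positivity), Nat.cast_ofNat, mul_div_cancel₀ _
      two_ne_zero, Real.div_rpow hb ha.le]
  have haq : 0 < a ^ q := by positivity
  have hsub : a ^ (q - 2) = a ^ q / a ^ 2 := by rw [Real.rpow_sub ha, Real.rpow_two]
  rw [add_sub_cancel, hpow, div_le_iff₀ haq] at hbernoulli
  calc b ^ q - a ^ q ≤ (1 + q / 2 * ((b / a) ^ 2 - 1)) * a ^ q - a ^ q := by gcongr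
    _ = q / 2 * a ^ (q - 2) * (b ^ 2 - a ^ 2) := by
      rw [hsub]
      field_simp
      ring

theorem sq_mul_volume_diff_support_le (hs : 0 < s) (hu : Measurable u) {r : ℝ} (hr : 0 < r)
    (x : EuclideanSpace ℝ (Fin N)) :
    ENNReal.ofReal (u x ^ 2) * volume (ball x r \ Function.support u) ≤
      ENNReal.ofReal (r ^ ((N : ℝ) + 2 * s)) * fracGradSq s u x := by
  rw [fracGradSq, ← lintegral_const_mul' _ _ ENNReal.ofReal_ne_top, ← lintegral_indicator_const
    (measurableSet_ball.diff (measurableSet_support hu))]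
  refine lintegral_mono (Set.indicator_le fun y hy => ?_)
  have huy : u y = 0 := Function.notMem_support.1 hy.2
  rw [huy, sub_zero, ← ENNReal.ofReal_mul (by positivity)]
  refine ENNReal.ofReal_le_ofReal ?_
  rcases eq_or_ne x y with rfl | hxy
  · simp [huy]
  have hpos : 0 < ‖x - y‖ := norm_pos_iff.2 (sub_ne_zero.2 hxy)
  have hle : ‖x - y‖ ≤ r := by simpa [dist_comm, dist_eq_norm] using (mem_ball.1 hy.1).le
  rw [mul_div_assoc', le_div_iff₀ (by positivity), mul_comm]
  gcongr

theorem volume_ball_mul_lintegral_sq_le (hs : 0 < s) (hu : Measurable u) {r : ℝ} (hr : 0 < r)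
    (hsupp : 2 * volume (Function.support u) ≤ volume (ball (0 : EuclideanSpace ℝ (Fin N)) r)) :
    volume (ball (0 : EuclideanSpace ℝ (Fin N)) 1) * ∫⁻ x, ENNReal.ofReal (u x ^ 2) ≤
      2 * ENNReal.ofReal (r ^ (2 * s)) * energy s u := by
  set S := Function.support u
  set B := volume (ball (0 : EuclideanSpace ℝ (Fin N)) r) with hB
  have hBfin : B ≠ ⊤ := measure_ball_lt_top.ne
  have hdiff (x : EuclideanSpace ℝ (Fin N)) : B ≤ 2 * volume (ball x r \ S) := by
    have hBx : B ≤ volume (ball x r \ S) + volume S := by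
      rw [hB, ← Measure.addHaar_ball_center volume x r]
      exact (measure_mono (by simp)).trans (measure_union_le _ S)
    refine (ENNReal.add_le_add_iff_right hBfin).1 ?_
    calc B + B ≤ 2 * (volume (ball x r \ S) + volume S) := by rw [← two_mul]; gcongr
      _ ≤ 2 * volume (ball x r \ S) + B := by rw [mul_add]; gcongr
  have hscale : B = ENNReal.ofReal (r ^ N) * volume (ball (0 : EuclideanSpace ℝ (Fin N)) 1) := by
    rw [hB, Measure.addHaar_ball_of_pos volume _ hr, finrank_euclideanSpace_fin]
  have hint : (∫⁻ x, ENNReal.ofReal (u x ^ 2)) * B ≤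
      2 * ENNReal.ofReal (r ^ ((N : ℝ) + 2 * s)) * energy s u := by
    rw [← lintegral_fracGradSq, ← lintegral_mul_const' _ _ hBfin, ← lintegral_const_mul' _ _
      (by finiteness)]
    refine lintegral_mono fun x => ?_
    calc ENNReal.ofReal (u x ^ 2) * B
        ≤ 2 * (ENNReal.ofReal (u x ^ 2) * volume (ball x r \ S)) := by
          rw [mul_left_comm]
          gcongr
          exact hdiff x
      _ ≤ 2 * ENNReal.ofReal (r ^ ((N : ℝ) + 2 * s)) * fracGradSq s u x := by
          rw [mul_assoc]
          gcongr 2 * ?_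
          exact sq_mul_volume_diff_support_le hs hu hr x
  rw [Real.rpow_add hr, Real.rpow_natCast, ENNReal.ofReal_mul (by positivity), hscale] at hint
  refine (ENNReal.mul_le_mul_iff_right (a := ENNReal.ofReal (r ^ N))
    (ENNReal.ofReal_pos.2 (by positivity)).ne' ENNReal.ofReal_ne_top).1 ?_
  convert hint using 1 <;> ring

theorem exists_le_volume_ball [NeZero N] {a : ℝ≥0∞} (ha : a ≠ ⊤) :
    ∃ r : ℝ, 0 < r ∧ a ≤ volume (ball (0 : EuclideanSpace ℝ (Fin N)) r) := by
  set b := volume (ball (0 : EuclideanSpace ℝ (Fin N)) 1)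
  have hb : b ≠ 0 := (measure_ball_pos _ _ one_pos).ne'
  have hdiv : a / b ≠ ⊤ := ENNReal.div_ne_top ha hb
  have hr : 1 ≤ max 1 (a / b).toReal := le_max_left _ _
  refine ⟨max 1 (a / b).toReal, by linarith, ?_⟩
  rw [Measure.addHaar_ball_of_pos volume _ (by linarith), finrank_euclideanSpace_fin]
  calc a = a / b * b := (ENNReal.div_mul_cancel hb measure_ball_lt_top.ne).symm
    _ ≤ _ := by
      gcongr
      rw [ENNReal.le_ofReal_iff_toReal_le hdiv (by positivity)]
      exact (le_max_right _ _).trans (le_self_pow₀ hr (NeZero.ne N))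

theorem integrable_sq_of_energy_ne_top [NeZero N] (hs : 0 < s) (hu : Measurable u)
    (hsupp : volume (Function.support u) ≠ ⊤) (hE : energy s u ≠ ⊤) :
    Integrable fun x => u x ^ 2 := by
  obtain ⟨r, hr, hle⟩ := exists_le_volume_ball (N := N) (a := 2 * volume (Function.support u))
    (by finiteness)
  refine ⟨(hu.pow_const 2).aestronglyMeasurable, ?_⟩
  rw [hasFiniteIntegral_iff_ofReal (ae_of_all _ fun x => sq_nonneg _), lt_top_iff_ne_top]
  refine fun htop => ne_top_of_le_ne_top (by finiteness)
    (volume_ball_mul_lintegral_sq_le hs hu hr hle) ?_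
  rw [htop, ENNReal.mul_top (measure_ball_pos _ _ one_pos).ne']

theorem integrable_rpow_of_energy_ne_top [NeZero N] (hs : 0 < s) (hq : q ∈ Set.Ioo (0 : ℝ) 2)
    (hu : Measurable u) (h0 : ∀ x, 0 ≤ u x) (hsupp : volume (Function.support u) ≠ ⊤)
    (hE : energy s u ≠ ⊤) : Integrable fun x => u x ^ q := by
  have hone : Integrable ((Function.support u).indicator fun _ => (1 : ℝ)) :=
    (integrable_indicator_iff (measurableSet_support hu)).2 (integrableOn_const hsupp)
  refine (hone.add (integrable_sq_of_energy_ne_top hs hu hsupp hE)).mono'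
    (hu.pow_const q).aestronglyMeasurable (ae_of_all _ fun x => ?_)
  rw [Real.norm_of_nonneg (Real.rpow_nonneg (h0 x) q), Pi.add_apply]
  rcases eq_or_ne (u x) 0 with hx | hx
  · simp [hx, hq.1.ne']
  rw [Set.indicator_of_mem (Function.mem_support.2 hx)]
  rcases le_total (u x) 1 with hle | hle
  · linarith [Real.rpow_le_one (h0 x) hle hq.1.le, sq_nonneg (u x)]
  · linarith [(Real.rpow_le_rpow_of_exponent_le hle hq.2.le).trans_eq (Real.rpow_two _)]

namespace IsBorelDensity

theorem support_subset (hu : IsBorelDensity U s q u) : Function.support u ⊆ U :=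
  Function.support_subset_iff'.2 fun _ => hu.eq_zero

variable [NeZero N]

theorem integrable_sq (hu : IsBorelDensity U s q u) (hs : s ∈ Set.Ioo (0 : ℝ) 1)
    (hU : volume U ≠ ⊤) : Integrable fun x => u x ^ 2 :=
  integrable_sq_of_energy_ne_top hs.1 hu.measurable
    (measure_ne_top_of_subset hu.support_subset hU) (hu.memD.energy_lt_top hs).ne

theorem integrable_and_energy_add_integral_le (hu : IsBorelDensity U s q u)
    (hs : s ∈ Set.Ioo (0 : ℝ) 1) (hq : q ∈ Set.Ioo (0 : ℝ) 2) (hU : volume U ≠ ⊤)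
    (hvD : MemD U s v) (hv : Measurable v) (hv0 : ∀ x, 0 ≤ v x) (hvU : Function.support v ⊆ U) :
    Integrable (fun x => v x ^ q - u x ^ q) ∧
      (energy s u).toReal + 2 / q * ∫ x, (v x ^ q - u x ^ q) ≤ (energy s v).toReal := by
  have hui := integrable_rpow_of_energy_ne_top hs.1 hq hu.measurable hu.nonneg
    (measure_ne_top_of_subset hu.support_subset hU) (hu.memD.energy_lt_top hs).ne
  have hvi := integrable_rpow_of_energy_ne_top hs.1 hq hv hv0
    (measure_ne_top_of_subset hvU hU) (hvD.energy_lt_top hs).ne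
  have hset {f : EuclideanSpace ℝ (Fin N) → ℝ} (hf : Function.support f ⊆ U) :
      ∫ x in U, f x ^ q = ∫ x, f x ^ q :=
    setIntegral_eq_integral_of_forall_compl_eq_zero fun x hx => by
      rw [Function.notMem_support.1 (mt (@hf x) hx), Real.zero_rpow hq.1.ne']
  have hmin := hu.isBoundedDensity.2 v hvD (ae_of_all _ hv0)
  rw [freeEnergy, freeEnergy, hset hu.support_subset, hset hvU] at hmin
  refine ⟨hvi.sub hui, ?_⟩
  rw [integral_sub hvi hui, show 2 / q = 2 * (1 / q) by ring]
  linarith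

end IsBorelDensity

/-! ### The Caccioppoli inequality -/

theorem sq_sub_posPart_add_le (a b c d : ℝ) :
    ((a - max (a - c) 0) - (b - max (b - d) 0)) ^ 2 +
      1 / 2 * (max (a - c) 0 - max (b - d) 0) ^ 2 ≤ (a - b) ^ 2 + 2 * (c - d) ^ 2 := by
  have hmono : (max (a - c) 0 - max (b - d) 0) ^ 2 ≤
      ((a - c) - (b - d)) * (max (a - c) 0 - max (b - d) 0) := by
    rcases max_cases (a - c) 0 with ⟨hac, _⟩ | ⟨hac, _⟩ <;>
    rcases max_cases (b - d) 0 with ⟨hbd, _⟩ | ⟨hbd, _⟩ <;> rw [hac, hbd] <;> nlinarith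
  nlinarith [sq_nonneg (max (a - c) 0 - max (b - d) 0 + 2 * (c - d))]

theorem energy_sub_posPart_add_le {h : EuclideanSpace ℝ (Fin N) → ℝ} (hu : Measurable u)
    (hh : Measurable h) {Γ : ℝ≥0∞} (hΓ : ∀ x, fracGradSq s h x ≤ Γ) :
    energy s (fun x => u x - max (u x - h x) 0) + 2⁻¹ * energy s (fun x => max (u x - h x) 0) ≤
      energy s u + 4 * Γ * volume {x | h x < u x} := by
  set A := {x | h x < u x}
  have hA : MeasurableSet A := measurableSet_lt hh hu
  set D : Set (EuclideanSpace ℝ (Fin N) × EuclideanSpace ℝ (Fin N)) :=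
    Prod.fst ⁻¹' A ∪ Prod.snd ⁻¹' A
  have hD : MeasurableSet D := (measurable_fst hA).union (measurable_snd hA)
  have hz : Measurable fun x => max (u x - h x) 0 := by fun_prop
  have hv : Measurable fun x => u x - max (u x - h x) 0 := hu.sub hz
  have hhalf : (2⁻¹ : ℝ≥0∞) = ENNReal.ofReal (1 / 2) := by
    rw [one_div, ENNReal.ofReal_inv_of_pos two_pos, ENNReal.ofReal_ofNat]
  rw [← lintegral_gagliardoMeasure hv.aemeasurable,
    ← lintegral_gagliardoMeasure hz.aemeasurable, ← lintegral_gagliardoMeasure hu.aemeasurable]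
  calc _ = ∫⁻ p, (ENNReal.ofReal (((u p.1 - max (u p.1 - h p.1) 0) -
          (u p.2 - max (u p.2 - h p.2) 0)) ^ 2) +
          2⁻¹ * ENNReal.ofReal ((max (u p.1 - h p.1) 0 - max (u p.2 - h p.2) 0) ^ 2))
          ∂gagliardoMeasure N s := by
        rw [lintegral_add_left (by fun_prop), lintegral_const_mul' _ _ (by simp)]
    _ ≤ ∫⁻ p, (ENNReal.ofReal ((u p.1 - u p.2) ^ 2) +
          2 * D.indicator (fun p => ENNReal.ofReal ((h p.1 - h p.2) ^ 2)) p)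
          ∂gagliardoMeasure N s := by
        refine lintegral_mono fun p => ?_
        by_cases hp : p ∈ D
        · rw [Set.indicator_of_mem hp, hhalf, ← ENNReal.ofReal_ofNat 2,
            ← ENNReal.ofReal_mul (by norm_num), ← ENNReal.ofReal_mul (by norm_num),
            ← ENNReal.ofReal_add (by positivity) (by positivity),
            ← ENNReal.ofReal_add (by positivity) (by positivity)]
          exact ENNReal.ofReal_le_ofReal (sq_sub_posPart_add_le _ _ _ _)
        · rw [Set.indicator_of_notMem hp]
          have hp' : u p.1 ≤ h p.1 ∧ u p.2 ≤ h p.2 := by simpa [D, A] using hp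
          simp [max_eq_right (sub_nonpos.2 hp'.1), max_eq_right (sub_nonpos.2 hp'.2)]
    _ = (∫⁻ p, ENNReal.ofReal ((u p.1 - u p.2) ^ 2) ∂gagliardoMeasure N s) +
          2 * ∫⁻ p in D, ENNReal.ofReal ((h p.1 - h p.2) ^ 2) ∂gagliardoMeasure N s := by
        rw [lintegral_add_left (by fun_prop), lintegral_const_mul' _ _ (by simp),
          lintegral_indicator hD]
    _ ≤ _ := by
        grw [setLIntegral_gagliardoMeasure_le hh hΓ hA]
        exact le_of_eq (by ring)

theorem toReal_energy_posPart_sub_le {h : EuclideanSpace ℝ (Fin N) → ℝ} (hu : Measurable u)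
    (hh : Measurable h) {Γ : ℝ} (hΓ0 : 0 ≤ Γ) (hΓ : ∀ x, fracGradSq s h x ≤ ENNReal.ofReal Γ)
    (hA : volume {x | h x < u x} ≠ ⊤) (hE : energy s u ≠ ⊤) :
    (energy s fun x => max (u x - h x) 0).toReal ≤
      2 * ((energy s u).toReal - (energy s fun x => u x - max (u x - h x) 0).toReal) +
        8 * Γ * volume.real {x | h x < u x} := by
  have hle := energy_sub_posPart_add_le hu hh hΓ
  have hfin : energy s u + 4 * ENNReal.ofReal Γ * volume {x | h x < u x} ≠ ⊤ := by finiteness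
  obtain ⟨hEv, hEz⟩ := ENNReal.add_ne_top.1 (ne_top_of_le_ne_top hfin hle)
  have hle' := ENNReal.toReal_mono hfin hle
  rw [ENNReal.toReal_add hEv hEz, ENNReal.toReal_add hE (by finiteness)] at hle'
  simp only [ENNReal.toReal_mul, ENNReal.toReal_inv, ENNReal.toReal_ofNat,
    ENNReal.toReal_ofReal hΓ0, ← measureReal_def] at hle'
  linarith

theorem rpow_sub_rpow_le_mul_sq {a c k μ : ℝ} (hq : q ∈ Set.Ioo (0 : ℝ) 2) (hk : 0 < k)
    (hkc : k ≤ c) (hca : c ≤ a) (hμ : k ^ (q - 2) ≤ μ) : a ^ q - c ^ q ≤ q / 2 * μ * a ^ 2 := by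
  have hc : 0 < c := hk.trans_le hkc
  have hcμ : c ^ (q - 2) ≤ μ :=
    (Real.rpow_le_rpow_of_nonpos hk hkc (by linarith [hq.2])).trans hμ
  have hq0 : 0 < q := hq.1
  calc a ^ q - c ^ q ≤ q / 2 * c ^ (q - 2) * (a ^ 2 - c ^ 2) :=
        rpow_sub_rpow_le_mul_sq_sub_sq hq.1.le hq.2.le hc (hc.le.trans hca)
    _ ≤ q / 2 * c ^ (q - 2) * a ^ 2 := by gcongr; linarith [sq_nonneg c]
    _ ≤ q / 2 * μ * a ^ 2 := by gcongr

namespace IsBorelDensity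

variable [NeZero N] {h : EuclideanSpace ℝ (Fin N) → ℝ} {k μ : ℝ}

theorem toReal_energy_le_add_integral (hu : IsBorelDensity U s q u) (hs : s ∈ Set.Ioo (0 : ℝ) 1)
    (hq : q ∈ Set.Ioo (0 : ℝ) 2) (hU : volume U ≠ ⊤) (hh : Measurable h) (hk : 0 < k)
    (hkh : ∀ x, k ≤ h x) (hμ : k ^ (q - 2) ≤ μ)
    (hD : MemD U s fun x => u x - max (u x - h x) 0) :
    (energy s u).toReal ≤ (energy s fun x => u x - max (u x - h x) 0).toReal +
      μ * ∫ x in {x | h x < u x}, u x ^ 2 := by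
  set A := {x | h x < u x}
  set v : EuclideanSpace ℝ (Fin N) → ℝ := fun x => u x - max (u x - h x) 0 with hv
  have hum := hu.measurable
  have hA : MeasurableSet A := measurableSet_lt hh hum
  have h0 (x) : 0 < h x := hk.trans_le (hkh x)
  have hvmin (x) : v x = min (u x) (h x) := by
    rcases le_total (u x) (h x) with hx | hx <;> simp [hv, hx]
  obtain ⟨hint, hmin⟩ := hu.integrable_and_energy_add_integral_le hs hq hU hD (by fun_prop)
    (fun x => (hvmin x).symm ▸ le_min (hu.nonneg x) (h0 x).le)
    (Function.support_subset_iff'.2 fun x hx => by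
      rw [hvmin, hu.eq_zero hx, min_eq_left (h0 x).le])
  have hq0 : 0 < q := hq.1
  have hgain : -∫ x, (v x ^ q - u x ^ q) ≤ q / 2 * μ * ∫ x in A, u x ^ 2 := by
    rw [← integral_neg, ← integral_const_mul, ← integral_indicator hA]
    refine integral_mono hint.neg ((integrable_indicator_iff hA).2
      ((hu.integrable_sq hs hU).integrableOn.const_mul _)) fun x => ?_
    by_cases hx : x ∈ A
    · have hx' : h x < u x := hx
      rw [Set.indicator_of_mem hx, hvmin, min_eq_right hx'.le, neg_sub]
      exact rpow_sub_rpow_le_mul_sq hq hk (hkh x) hx'.le hμ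
    · rw [Set.indicator_of_notMem hx, hvmin, min_eq_left (not_lt.1 hx), sub_self, neg_zero]
  calc (energy s u).toReal
      ≤ (energy s v).toReal + 2 / q * -∫ x, (v x ^ q - u x ^ q) := by linarith
    _ ≤ (energy s v).toReal + 2 / q * (q / 2 * μ * ∫ x in A, u x ^ 2) := by gcongr
    _ = (energy s v).toReal + μ * ∫ x in A, u x ^ 2 := by field_simp

theorem toReal_energy_posPart_sub_le (hu : IsBorelDensity U s q u)
    (hs : s ∈ Set.Ioo (0 : ℝ) 1) (hq : q ∈ Set.Ioo (0 : ℝ) 2) (hUm : MeasurableSet U)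
    (hU : volume U ≠ ⊤) (hh : ContDiff ℝ ∞ h) (hk : 0 < k) (hkh : ∀ x, k ≤ h x)
    (hμ : k ^ (q - 2) ≤ μ) (hgrad : ∀ x, fracGradSq s h x ≤ ENNReal.ofReal (k ^ 2 * μ)) :
    (energy s fun x => max (u x - h x) 0).toReal ≤ 10 * μ * ∫ x in {x | h x < u x}, u x ^ 2 := by
  set A := {x | h x < u x}
  have hhm := hh.continuous.measurable
  have h0 (x) : 0 < h x := hk.trans_le (hkh x)
  have hμ0 : 0 < μ := (Real.rpow_pos_of_pos hk _).trans_le hμ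
  have hA : volume A ≠ ⊤ :=
    measure_ne_top_of_subset (fun x hx => hu.support_subset ((h0 x).trans hx).ne') hU
  have hD : MemD U s fun x => u x - max (u x - h x) 0 := hu.memD.sub
    (hu.memD.posPart_sub hs hUm hU hh (fun x => (h0 x).le) ENNReal.ofReal_ne_top hgrad)
  have hvol : k ^ 2 * volume.real A ≤ ∫ x in A, u x ^ 2 :=
    setIntegral_ge_of_const_le_real (measurableSet_lt hhm hu.measurable) hA
      (fun x hx => pow_le_pow_left₀ hk.le ((hkh x).trans (le_of_lt hx)) 2)
      (hu.integrable_sq hs hU).integrableOn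
  have hmin := hu.toReal_energy_le_add_integral hs hq hU hhm hk hkh hμ hD
  calc (energy s fun x => max (u x - h x) 0).toReal
      ≤ 2 * ((energy s u).toReal - (energy s fun x => u x - max (u x - h x) 0).toReal) +
          8 * (k ^ 2 * μ) * volume.real A :=
        FracLaneEmden.toReal_energy_posPart_sub_le hu.measurable hhm (by positivity) hgrad hA
          (hu.memD.energy_lt_top hs).ne
    _ ≤ 2 * (μ * ∫ x in A, u x ^ 2) + 8 * μ * (k ^ 2 * volume.real A) := by linarith
    _ ≤ 2 * (μ * ∫ x in A, u x ^ 2) + 8 * μ * ∫ x in A, u x ^ 2 := by gcongr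
    _ = 10 * μ * ∫ x in A, u x ^ 2 := by ring

end IsBorelDensity

/-! ### De Giorgi iteration -/

/-- The volume of the unit ball of `ℝ^N`, as a real number. -/
noncomputable def unitBallVolume (N : ℕ) : ℝ :=
  volume.real (ball (0 : EuclideanSpace ℝ (Fin N)) 1)

theorem unitBallVolume_pos (N : ℕ) : 0 < unitBallVolume N :=
  ENNReal.toReal_pos (measure_ball_pos _ _ one_pos).ne' measure_ball_lt_top.ne

theorem volumeReal_ball (x : EuclideanSpace ℝ (Fin N)) {r : ℝ} (hr : 0 < r) :
    volume.real (ball x r) = unitBallVolume N * r ^ N := by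
  rw [measureReal_def, Measure.addHaar_ball_of_pos volume _ hr, finrank_euclideanSpace_fin,
    ENNReal.toReal_mul, ENNReal.toReal_ofReal (by positivity), mul_comm]
  rfl

theorem unitBallVolume_mul_integral_sq_le (hs : 0 < s) (hu : Measurable u)
    (hfin : volume (Function.support u) ≠ ⊤) (hE : energy s u ≠ ⊤) {r : ℝ} (hr : 0 < r)
    (hsupp : 2 * volume.real (Function.support u) ≤ unitBallVolume N * r ^ N) :
    unitBallVolume N * ∫ x, u x ^ 2 ≤ 2 * r ^ (2 * s) * (energy s u).toReal := by
  rw [← volumeReal_ball 0 hr, measureReal_def, measureReal_def, ← ENNReal.toReal_ofNat,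
    ← ENNReal.toReal_mul, ENNReal.toReal_le_toReal (by finiteness) measure_ball_lt_top.ne] at hsupp
  have hle := ENNReal.toReal_mono (by finiteness) (volume_ball_mul_lintegral_sq_le hs hu hr hsupp)
  rwa [ENNReal.toReal_mul, ENNReal.toReal_mul, ENNReal.toReal_mul, ENNReal.toReal_ofNat,
    ENNReal.toReal_ofReal (by positivity), ← integral_eq_lintegral_of_nonneg_ae
      (ae_of_all _ fun x => sq_nonneg _) (hu.pow_const 2).aestronglyMeasurable] at hle

/-- The squared `L²` norm of the part of `u` above the level `k * H`: the quantity iterated over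
increasing levels `k` in the De Giorgi scheme, where `H ≥ 1` is a fixed profile. -/
noncomputable def excess (u H : EuclideanSpace ℝ (Fin N) → ℝ) (k : ℝ) : ℝ :=
  ∫ x, max (u x - k * H x) 0 ^ 2

section excess

variable {H : EuclideanSpace ℝ (Fin N) → ℝ} {a b : ℝ}

theorem excess_nonneg : 0 ≤ excess u H a := integral_nonneg fun _ => sq_nonneg _

theorem integrable_posPart_sub_mul_sq (hu : Measurable u) (hu0 : ∀ x, 0 ≤ u x)
    (hu2 : Integrable fun x => u x ^ 2) (hH : Measurable H) (hH0 : ∀ x, 0 ≤ H x) (ha : 0 ≤ a) :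
    Integrable fun x => max (u x - a * H x) 0 ^ 2 := by
  refine hu2.mono' (by fun_prop) (ae_of_all _ fun x => ?_)
  rw [Real.norm_of_nonneg (sq_nonneg _)]
  exact pow_le_pow_left₀ (le_max_right _ _)
    (max_le (sub_le_self _ (mul_nonneg ha (hH0 x))) (hu0 x)) 2

theorem excess_antitoneOn (hu : Measurable u) (hu0 : ∀ x, 0 ≤ u x)
    (hu2 : Integrable fun x => u x ^ 2) (hH : Measurable H) (hH0 : ∀ x, 0 ≤ H x) :
    AntitoneOn (excess u H) (Set.Ici 0) := by
  intro a ha b hb hab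
  refine integral_mono (integrable_posPart_sub_mul_sq hu hu0 hu2 hH hH0 hb)
    (integrable_posPart_sub_mul_sq hu hu0 hu2 hH hH0 ha) fun x => ?_
  have := hH0 x
  dsimp only
  gcongr

theorem excess_le_integral_sq (hu : Measurable u) (hu0 : ∀ x, 0 ≤ u x)
    (hu2 : Integrable fun x => u x ^ 2) (hH : Measurable H) (hH0 : ∀ x, 0 ≤ H x) (ha : 0 ≤ a) :
    excess u H a ≤ ∫ x, u x ^ 2 := by
  refine (excess_antitoneOn hu hu0 hu2 hH hH0 Set.self_mem_Ici ha ha).trans_eq ?_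
  simp [excess, hu0]

theorem sq_sub_mul_volumeReal_le_excess (hu : Measurable u) (hu0 : ∀ x, 0 ≤ u x)
    (hu2 : Integrable fun x => u x ^ 2) (hH : Measurable H) (hH1 : ∀ x, 1 ≤ H x) (ha : 0 ≤ a)
    (hab : a < b) (hfin : volume {x | b * H x < u x} ≠ ⊤) :
    (b - a) ^ 2 * volume.real {x | b * H x < u x} ≤ excess u H a := by
  have hint := integrable_posPart_sub_mul_sq hu hu0 hu2 hH (fun x => zero_le_one.trans (hH1 x)) ha
  refine (setIntegral_ge_of_const_le_real (measurableSet_lt (hH.const_mul b) hu) hfin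
    (fun x hx => pow_le_pow_left₀ (sub_nonneg.2 hab.le) ?_ 2) hint.integrableOn).trans
    (setIntegral_le_integral hint (ae_of_all _ fun x => sq_nonneg _))
  have hx' : b * H x < u x := hx
  refine le_max_of_le_left ?_
  nlinarith [hH1 x]

theorem setIntegral_sq_le_excess (hu : Measurable u) (hu0 : ∀ x, 0 ≤ u x)
    (hu2 : Integrable fun x => u x ^ 2) (hH : Measurable H) (hH0 : ∀ x, 0 ≤ H x) (ha : 0 ≤ a)
    (hab : a < b) :
    ∫ x in {x | b * H x < u x}, u x ^ 2 ≤ (b / (b - a)) ^ 2 * excess u H a := by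
  have hint := (integrable_posPart_sub_mul_sq hu hu0 hu2 hH hH0 ha).const_mul ((b / (b - a)) ^ 2)
  have hba : 0 < b - a := sub_pos.2 hab
  rw [excess, ← integral_const_mul]
  refine (setIntegral_mono_on hu2.integrableOn hint.integrableOn
    (measurableSet_lt (hH.const_mul b) hu) fun x hx => ?_).trans
    (setIntegral_le_integral hint (ae_of_all _ fun x => by positivity))
  have hx' : b * H x < u x := hx
  rw [← mul_pow]
  refine pow_le_pow_left₀ (hu0 x) ?_ 2
  have hux : u x ≤ b / (b - a) * (u x - a * H x) := by
    rw [div_mul_eq_mul_div, le_div_iff₀ hba]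
    nlinarith
  exact hux.trans (by have := ha.trans_lt hab; gcongr; exact le_max_left _ _)

end excess

theorem support_posPart_sub {h : EuclideanSpace ℝ (Fin N) → ℝ} :
    Function.support (fun x => max (u x - h x) 0) = {x | h x < u x} := by
  ext x
  simp

theorem IsBorelDensity.excess_le [NeZero N] (hu : IsBorelDensity U s q u)
    (hs : s ∈ Set.Ioo (0 : ℝ) 1) (hq : q ∈ Set.Ioo (0 : ℝ) 2) (hUm : MeasurableSet U)
    (hU : volume U ≠ ⊤) {H : EuclideanSpace ℝ (Fin N) → ℝ} (hH : ContDiff ℝ ∞ H)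
    (hH1 : ∀ x, 1 ≤ H x) {K μ : ℝ} (hK : 0 < K) (hμ : K ^ (q - 2) ≤ μ)
    (hgrad : ∀ x, fracGradSq s H x ≤ ENNReal.ofReal μ)
    {a b r : ℝ} (hKa : K ≤ a) (hab : a < b) (hr : 0 < r)
    (hsmall : 2 * excess u H a ≤ (b - a) ^ 2 * (unitBallVolume N * r ^ N)) :
    excess u H b ≤
      20 * μ / unitBallVolume N * r ^ (2 * s) * (b / (b - a)) ^ 2 * excess u H a := by
  have hHm := hH.continuous.measurable
  have ha : 0 < a := hK.trans_le hKa
  have hb : 0 < b := ha.trans hab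
  have hH0 (x) : 0 ≤ H x := zero_le_one.trans (hH1 x)
  have hμ0 : 0 < μ := (Real.rpow_pos_of_pos hK _).trans_le hμ
  have hu2 := hu.integrable_sq hs hU
  have hbH (x) : b ≤ b * H x := le_mul_of_one_le_right hb.le (hH1 x)
  have hbμ : b ^ (q - 2) ≤ μ :=
    (Real.rpow_le_rpow_of_nonpos hK (hKa.trans hab.le) (by linarith [hq.2])).trans hμ
  have hbgrad (x) : fracGradSq s (fun x => b * H x) x ≤ ENNReal.ofReal (b ^ 2 * μ) := by
    rw [fracGradSq_const_mul, ENNReal.ofReal_mul (sq_nonneg b)]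
    exact mul_le_mul_right (hgrad x) _
  have hfin : volume {x | b * H x < u x} ≠ ⊤ := measure_ne_top_of_subset
    (fun x hx => hu.support_subset ((hb.trans_le (hbH x)).trans hx).ne') hU
  have hvol : 2 * volume.real {x | b * H x < u x} ≤ unitBallVolume N * r ^ N := by
    have hcheb := sq_sub_mul_volumeReal_le_excess hu.measurable hu.nonneg hu2 hHm hH1 ha.le hab hfin
    refine le_of_mul_le_mul_left ?_ (pow_pos (sub_pos.2 hab) 2)
    linarith
  have hzD : MemD U s fun x => max (u x - b * H x) 0 :=
    hu.memD.posPart_sub hs hUm hU (contDiff_const.mul hH) (fun x => mul_nonneg hb.le (hH0 x))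
      ENNReal.ofReal_ne_top hbgrad
  rw [div_mul_eq_mul_div, div_mul_eq_mul_div, div_mul_eq_mul_div,
    le_div_iff₀' (unitBallVolume_pos N)]
  calc unitBallVolume N * excess u H b
      ≤ 2 * r ^ (2 * s) * (energy s fun x => max (u x - b * H x) 0).toReal :=
        unitBallVolume_mul_integral_sq_le hs.1 (by have := hu.measurable; fun_prop)
          (support_posPart_sub ▸ hfin) (hzD.energy_lt_top hs).ne hr (support_posPart_sub ▸ hvol)
    _ ≤ 2 * r ^ (2 * s) * (10 * μ * ((b / (b - a)) ^ 2 * excess u H a)) := by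
        gcongr
        refine (hu.toReal_energy_posPart_sub_le hs hq hUm hU (contDiff_const.mul hH) hb hbH hbμ
          hbgrad).trans ?_
        gcongr
        exact setIntegral_sq_le_excess hu.measurable hu.nonneg hu2 hHm hH0 ha.le hab
    _ = _ := by ring

/-- The ratio of the geometric decay in the De Giorgi iteration, for measures of balls growing
like `r ^ n` and a gain of `r ^ σ` at scale `r`. The scale shrinks by `(1 / 4) ^ (1 / σ)` in each
step, so that this gain beats the factor `4` lost by halving the gap between the levels. -/
noncomputable def deGiorgiFactor (n : ℕ) (σ : ℝ) : ℝ :=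
  ((1 / 4) ^ (1 / σ)) ^ n / 4

theorem deGiorgiFactor_pos (n : ℕ) (σ : ℝ) : 0 < deGiorgiFactor n σ := by
  unfold deGiorgiFactor
  positivity

theorem deGiorgiFactor_lt_one (n : ℕ) {σ : ℝ} (hσ : 0 < σ) : deGiorgiFactor n σ < 1 := by
  have hle : ((1 / 4 : ℝ) ^ (1 / σ)) ^ n ≤ 1 :=
    pow_le_one₀ (by positivity) (Real.rpow_le_one (by norm_num) (by norm_num) (by positivity))
  unfold deGiorgiFactor
  linarith

theorem deGiorgiFactor_pow (n j : ℕ) (σ : ℝ) :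
    deGiorgiFactor n σ ^ j = (((1 / 4) ^ (1 / σ)) ^ j) ^ n * (1 / 4) ^ j := by
  rw [deGiorgiFactor, div_eq_mul_one_div, mul_pow, pow_right_comm]

section deGiorgi

variable {Y : ℝ → ℝ} {A K σ κ ρ : ℝ} {n : ℕ}

theorem le_mul_of_deGiorgi_step {a d r δ : ℝ} (hY0 : 0 ≤ Y a) (hA : 0 ≤ A)
    (step : ∀ a b r, K ≤ a → a < b → 0 < r → 2 * Y a ≤ (b - a) ^ 2 * (κ * r ^ n) →
      Y b ≤ A * r ^ σ * (b / (b - a)) ^ 2 * Y a)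
    (hK : 0 < K) (hKa : K ≤ a) (hd : 0 < d) (had : a + d ≤ 2 * K) (hr : 0 < r)
    (hscale : 2 * Y a ≤ d ^ 2 * (κ * r ^ n)) (hδ : 4 * K ^ 2 * (A * r ^ σ) ≤ δ * d ^ 2) :
    Y (a + d) ≤ δ * Y a := by
  have hle := step a (a + d) r hKa (by linarith) hr (by rwa [add_sub_cancel_left])
  rw [add_sub_cancel_left] at hle
  refine hle.trans (mul_le_mul_of_nonneg_right ?_ hY0)
  rw [div_pow, ← mul_div_assoc, div_le_iff₀ (by positivity)]
  refine le_trans ?_ hδ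
  rw [mul_comm, show 4 * K ^ 2 = (2 * K) ^ 2 by ring]
  have : 0 ≤ a + d := by linarith
  gcongr

theorem le_deGiorgiFactor_pow_mul (hY0 : ∀ k, 0 ≤ Y k) (hA : 0 ≤ A) (hK : 0 < K) (hσ : 0 < σ)
    (hρ : 0 < ρ)
    (step : ∀ a b r, K ≤ a → a < b → 0 < r → 2 * Y a ≤ (b - a) ^ 2 * (κ * r ^ n) →
      Y b ≤ A * r ^ σ * (b / (b - a)) ^ 2 * Y a)
    (hstart : 8 * Y K ≤ K ^ 2 * (κ * ρ ^ n)) (hsmall : 16 * (A * ρ ^ σ) ≤ deGiorgiFactor n σ)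
    (j : ℕ) : Y (K * (2 - (1 / 2) ^ j)) ≤ deGiorgiFactor n σ ^ j * Y K := by
  induction j with
  | zero => simp [show K * (2 - 1) = K by ring]
  | succ j ih =>
    have hδ := deGiorgiFactor_pos n σ
    set δ := deGiorgiFactor n σ
    set τ : ℝ := (1 / 4) ^ (1 / σ) with hτ_def
    have hτ : 0 < τ := by positivity
    have hpos : 0 < (1 / 2 : ℝ) ^ j := by positivity
    have hle : (1 / 2 : ℝ) ^ j ≤ 1 := pow_le_one₀ (by norm_num) (by norm_num)
    have hquarter : (1 / 4 : ℝ) ^ j = ((1 / 2) ^ j) ^ 2 := by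
      rw [← pow_mul, mul_comm, pow_mul]
      norm_num
    have hgain : (ρ * τ ^ j) ^ σ = ρ ^ σ * ((1 / 2) ^ j) ^ 2 := by
      rw [Real.mul_rpow hρ.le (by positivity), ← Real.rpow_pow_comm hτ.le, hτ_def,
        ← Real.rpow_mul (by norm_num), one_div_mul_cancel hσ.ne', Real.rpow_one, hquarter]
    have hscale : 2 * Y (K * (2 - (1 / 2) ^ j)) ≤
        (K * (1 / 2) ^ (j + 1)) ^ 2 * (κ * (ρ * τ ^ j) ^ n) := by
      calc 2 * Y (K * (2 - (1 / 2) ^ j)) ≤ 1 / 4 * δ ^ j * (8 * Y K) := by linarith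
        _ ≤ 1 / 4 * δ ^ j * (K ^ 2 * (κ * ρ ^ n)) := by gcongr
        _ = (K * (1 / 2) ^ (j + 1)) ^ 2 * (κ * (ρ * τ ^ j) ^ n) := by
          rw [deGiorgiFactor_pow, ← hτ_def, hquarter]
          ring
    have hstep : Y (K * (2 - (1 / 2) ^ j) + K * (1 / 2) ^ (j + 1)) ≤
        δ * Y (K * (2 - (1 / 2) ^ j)) := by
      refine le_mul_of_deGiorgi_step (hY0 _) hA step hK
        (le_mul_of_one_le_right hK.le (by linarith)) (by positivity) (by rw [pow_succ]; nlinarith)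
        (r := ρ * τ ^ j) (by positivity) hscale ?_
      calc 4 * K ^ 2 * (A * (ρ * τ ^ j) ^ σ)
          = 16 * (A * ρ ^ σ) * (K * (1 / 2) ^ (j + 1)) ^ 2 := by rw [hgain]; ring
        _ ≤ δ * (K * (1 / 2) ^ (j + 1)) ^ 2 := by gcongr
    calc Y (K * (2 - (1 / 2) ^ (j + 1)))
        = Y (K * (2 - (1 / 2) ^ j) + K * (1 / 2) ^ (j + 1)) := by congr 1; ring
      _ ≤ δ * Y (K * (2 - (1 / 2) ^ j)) := hstep
      _ ≤ δ * (δ ^ j * Y K) := by gcongr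
      _ = δ ^ (j + 1) * Y K := by ring

theorem eq_zero_of_deGiorgi_iteration (hY0 : ∀ k, 0 ≤ Y k) (hY : AntitoneOn Y (Set.Ici 0))
    (hA : 0 ≤ A) (hK : 0 < K) (hσ : 0 < σ) (hρ : 0 < ρ)
    (step : ∀ a b r, K ≤ a → a < b → 0 < r → 2 * Y a ≤ (b - a) ^ 2 * (κ * r ^ n) →
      Y b ≤ A * r ^ σ * (b / (b - a)) ^ 2 * Y a)
    (hstart : 8 * Y K ≤ K ^ 2 * (κ * ρ ^ n)) (hsmall : 16 * (A * ρ ^ σ) ≤ deGiorgiFactor n σ) :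
    Y (2 * K) = 0 := by
  have hlim : Tendsto (fun j : ℕ => deGiorgiFactor n σ ^ j * Y K) atTop (𝓝 (0 * Y K)) :=
    (tendsto_pow_atTop_nhds_zero_of_lt_one (deGiorgiFactor_pos n σ).le
      (deGiorgiFactor_lt_one n hσ)).mul_const _
  rw [zero_mul] at hlim
  refine le_antisymm (ge_of_tendsto' hlim fun j => ?_) (hY0 _)
  have hpos : 0 < (1 / 2 : ℝ) ^ j := by positivity
  have hle : (1 / 2 : ℝ) ^ j ≤ 1 := pow_le_one₀ (by norm_num) (by norm_num)
  refine (hY (Set.mem_Ici.2 ?_) (Set.mem_Ici.2 ?_) ?_).trans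
    (le_deGiorgiFactor_pow_mul hY0 hA hK hσ hρ step hstart hsmall j)
  · exact mul_nonneg hK.le (by linarith)
  · positivity
  · nlinarith

end deGiorgi

theorem IsBorelDensity.ae_le_of_excess_le [NeZero N] (hu : IsBorelDensity U s q u)
    (hs : s ∈ Set.Ioo (0 : ℝ) 1) (hq : q ∈ Set.Ioo (0 : ℝ) 2) (hUm : MeasurableSet U)
    (hU : volume U ≠ ⊤) {H : EuclideanSpace ℝ (Fin N) → ℝ} (hH : ContDiff ℝ ∞ H)
    (hH1 : ∀ x, 1 ≤ H x) {K μ ρ : ℝ} (hK : 0 < K) (hμ : K ^ (q - 2) ≤ μ)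
    (hgrad : ∀ x, fracGradSq s H x ≤ ENNReal.ofReal μ) (hρ : 0 < ρ)
    (hstart : 8 * excess u H K ≤ K ^ 2 * (unitBallVolume N * ρ ^ N))
    (hsmall : 320 * μ * ρ ^ (2 * s) ≤ unitBallVolume N * deGiorgiFactor N (2 * s)) :
    ∀ᵐ x, u x ≤ 2 * K * H x := by
  have hV := unitBallVolume_pos N
  have hμ0 : 0 < μ := (Real.rpow_pos_of_pos hK _).trans_le hμ
  have hH0 (x) : 0 ≤ H x := zero_le_one.trans (hH1 x)
  have hHm := hH.continuous.measurable
  have hu2 := hu.integrable_sq hs hU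
  have hzero : excess u H (2 * K) = 0 :=
    eq_zero_of_deGiorgi_iteration (fun _ => excess_nonneg)
      (excess_antitoneOn hu.measurable hu.nonneg hu2 hHm hH0) (by positivity) hK
      (mul_pos two_pos hs.1) hρ (fun a b r => hu.excess_le hs hq hUm hU hH hH1 hK hμ hgrad) hstart
      (by rw [div_mul_eq_mul_div, mul_div_assoc', div_le_iff₀' hV]; linarith)
  rw [excess, integral_eq_zero_iff_of_nonneg (fun x => sq_nonneg _)
    (integrable_posPart_sub_mul_sq hu.measurable hu.nonneg hu2 hHm hH0 (by positivity))] at hzero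
  filter_upwards [hzero] with x hx
  simpa using hx

/-! ### The first eigenvalue and the upper bound -/

theorem IsTestFunction.setIntegral_abs_rpow (hφ : IsTestFunction U φ) {p : ℝ} (hp : p ≠ 0) :
    ∫ x in U, |φ x| ^ p = ∫ x, |φ x| ^ p :=
  setIntegral_eq_integral_of_forall_compl_eq_zero fun x hx => by
    rw [hφ.eq_zero hx, abs_zero, Real.zero_rpow hp]

theorem firstEigenvalue_anti (hUV : U ⊆ V) {p : ℝ} (hp : p ≠ 0) :
    firstEigenvalue V s p ≤ firstEigenvalue U s p := by
  refine le_iInf fun φ => le_iInf fun hφ => le_iInf fun h1 =>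
    iInf_le_of_le φ (iInf_le_of_le (hφ.mono hUV) (iInf_le_of_le ?_ le_rfl))
  rwa [(hφ.mono hUV).setIntegral_abs_rpow hp, ← hφ.setIntegral_abs_rpow hp]

theorem IsTestFunction.integrable_sq (hφ : IsTestFunction U φ) : Integrable fun x => φ x ^ 2 := by
  simp only [sq]
  exact (hφ.continuous.mul hφ.continuous).integrable_of_hasCompactSupport hφ.2.1.mul_left

theorem IsTestFunction.firstEigenvalue_mul_lintegral_sq_le (hφ : IsTestFunction U φ) :
    firstEigenvalue U s 2 * ∫⁻ x, ENNReal.ofReal (φ x ^ 2) ≤ energy s φ := by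
  rw [← ofReal_integral_eq_lintegral_ofReal hφ.integrable_sq (ae_of_all _ fun _ => sq_nonneg _)]
  set I := ∫ x, φ x ^ 2 with hI
  have hI0 : 0 ≤ I := integral_nonneg fun x => sq_nonneg _
  rcases hI0.eq_or_lt with h0 | h0
  · simp [← h0]
  have hnormalized := hφ.const_mul (√I)⁻¹
  have hsq : (√I)⁻¹ ^ 2 = I⁻¹ := by rw [inv_pow, Real.sq_sqrt hI0]
  have hone : ∫ x in U, |(√I)⁻¹ * φ x| ^ (2 : ℝ) = 1 := by
    rw [hnormalized.setIntegral_abs_rpow two_ne_zero]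
    simp only [Real.rpow_two, sq_abs, mul_pow, hsq]
    rw [integral_const_mul, ← hI, inv_mul_cancel₀ h0.ne']
  have hle : firstEigenvalue U s 2 ≤ energy s fun x => (√I)⁻¹ * φ x :=
    iInf_le_of_le _ (iInf_le_of_le hnormalized (iInf_le _ hone))
  rw [energy_const_mul, hsq, ENNReal.ofReal_inv_of_pos h0] at hle
  rwa [← ENNReal.le_div_iff_mul_le (.inl (ENNReal.ofReal_pos.2 h0).ne')
    (.inl ENNReal.ofReal_ne_top), ENNReal.div_eq_inv_mul]

theorem MemD.mul_lintegral_sq_le (hu : MemD U s u) {l : ℝ≥0∞} (hl : l ≤ firstEigenvalue U s 2)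
    (hltop : l ≠ ⊤) : l * ∫⁻ x, ENNReal.ofReal (u x ^ 2) ≤ 2 * energy s u := by
  have hum := hu.aemeasurable
  obtain ⟨φ, hφ, hφl, hφE⟩ := hu
  have hbound (n) : l * ∫⁻ x, ENNReal.ofReal (φ n x ^ 2) ≤
      2 * energy s (φ n - u) + 2 * energy s u := by
    refine ((mul_le_mul_left hl _).trans (hφ n).firstEigenvalue_mul_lintegral_sq_le).trans ?_
    rw [energy_sub_comm, add_comm]
    conv_lhs => rw [← sub_sub_cancel u (φ n)]
    exact energy_sub_le hum (hum.sub (hφ n).measurable.aemeasurable)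
  have hlim : Tendsto (fun n => 2 * energy s (φ n - u) + 2 * energy s u) atTop
      (𝓝 (2 * 0 + 2 * energy s u)) :=
    (ENNReal.Tendsto.const_mul hφE (.inr (by finiteness))).add tendsto_const_nhds
  rw [mul_zero, zero_add] at hlim
  rw [← lintegral_const_mul' _ _ hltop]
  calc ∫⁻ x, l * ENNReal.ofReal (u x ^ 2)
      ≤ ∫⁻ x, liminf (fun n => l * ENNReal.ofReal (φ n x ^ 2)) atTop := by
        refine lintegral_mono_ae ?_
        filter_upwards [hφl] with x hx
        exact (ENNReal.Tendsto.const_mul (ENNReal.tendsto_ofReal (hx.pow 2))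
          (.inr hltop)).liminf_eq.ge
    _ ≤ liminf (fun n => ∫⁻ x, l * ENNReal.ofReal (φ n x ^ 2)) atTop :=
        lintegral_liminf_le fun n => ((hφ n).measurable.pow_const 2).ennreal_ofReal.const_mul l
    _ = liminf (fun n => l * ∫⁻ x, ENNReal.ofReal (φ n x ^ 2)) atTop := by
        simp only [lintegral_const_mul' _ _ hltop]
    _ ≤ 2 * energy s u := hlim.liminf_eq ▸ liminf_le_liminf (Eventually.of_forall hbound)

theorem MemD.mul_integral_sq_le (hu : MemD U s u) (hE : energy s u ≠ ⊤) {l : ℝ} (hl0 : 0 ≤ l)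
    (hl : ENNReal.ofReal l ≤ firstEigenvalue U s 2) :
    l * ∫ x, u x ^ 2 ≤ 2 * (energy s u).toReal := by
  rw [integral_eq_lintegral_of_nonneg_ae (ae_of_all _ fun x => sq_nonneg _)
    (hu.aemeasurable.pow_const 2).aestronglyMeasurable]
  have hle := ENNReal.toReal_mono (by finiteness) (hu.mul_lintegral_sq_le hl ENNReal.ofReal_ne_top)
  rwa [ENNReal.toReal_mul, ENNReal.toReal_mul, ENNReal.toReal_ofReal hl0,
    ENNReal.toReal_ofNat] at hle

theorem exists_cutoff [NeZero N] (hs : s ∈ Set.Ioo (0 : ℝ) 1) :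
    ∃ c : ℝ, 0 < c ∧ ∀ R, 0 < R → ∀ x₀ : EuclideanSpace ℝ (Fin N),
      ∃ H : EuclideanSpace ℝ (Fin N) → ℝ, ContDiff ℝ ∞ H ∧ (∀ x, 1 ≤ H x) ∧
        (∀ x ∈ ball x₀ (R / 2), H x = 1) ∧ (∀ x ∉ ball x₀ R, H x = 4) ∧
        ∀ x, fracGradSq s H x ≤ ENNReal.ofReal (c * R ^ (-(2 * s))) := by
  let f : ContDiffBump (0 : EuclideanSpace ℝ (Fin N)) := ⟨1 / 2, 1, by norm_num, by norm_num⟩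
  have hf : IsTestFunction Set.univ f := ⟨f.contDiff, f.hasCompactSupport, Set.subset_univ _⟩
  obtain ⟨Γ, hΓ0, hΓ⟩ := hf.exists_fracGradSq_le hs
  refine ⟨3 ^ 2 * Γ, by positivity, fun R hR x₀ => ?_⟩
  have hnorm (x) : ‖R⁻¹ • (x - x₀)‖ = dist x x₀ / R := by
    rw [norm_smul, norm_inv, Real.norm_of_nonneg hR.le, ← dist_eq_norm, inv_mul_eq_div]
  refine ⟨fun x => 4 - 3 * f (R⁻¹ • (x - x₀)), ?_, fun x => ?_, fun x hx => ?_, fun x hx => ?_,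
    fun x => ?_⟩
  · exact contDiff_const.sub (contDiff_const.mul
      (f.contDiff.comp ((contDiff_id.sub contDiff_const).const_smul R⁻¹)))
  · linarith [f.le_one (x := R⁻¹ • (x - x₀))]
  · have hfx : f (R⁻¹ • (x - x₀)) = 1 := f.one_of_mem_closedBall <| by
      rw [mem_closedBall_zero_iff, hnorm]
      exact (div_le_iff₀ hR).2 ((le_of_lt hx).trans_eq (by ring))
    simp only [hfx]
    norm_num
  · have hfx : f (R⁻¹ • (x - x₀)) = 0 := f.zero_of_le_dist <| by
      rw [dist_zero_right, hnorm]
      exact (one_le_div hR).2 (not_lt.1 hx)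
    simp only [hfx]
    norm_num
  · rw [fracGradSq_const_sub, fracGradSq_const_mul, fracGradSq_comp_inv_smul_sub hR, mul_assoc,
      ENNReal.ofReal_mul (by positivity), mul_comm Γ, ENNReal.ofReal_mul (by positivity)]
    gcongr
    exact hΓ _

theorem ae_of_forall_ae_mem_ball {p : EuclideanSpace ℝ (Fin N) → Prop} {r : ℝ} (hr : 0 < r)
    (h : ∀ x₀, ∀ᵐ x, x ∈ ball x₀ r → p x) : ∀ᵐ x, p x := by
  refine measure_null_of_locally_null _ fun x₀ _ =>
    ⟨{x | ¬p x} ∩ ball x₀ r, inter_mem_nhdsWithin _ (ball_mem_nhds _ hr), ?_⟩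
  refine measure_mono_null (fun x hx => ?_) (h x₀)
  exact fun hp => hx.1 (hp hx.2)

namespace IsBorelDensity

variable [NeZero N] (hu : IsBorelDensity U s q u) (hs : s ∈ Set.Ioo (0 : ℝ) 1)
  (hq : q ∈ Set.Ioo (0 : ℝ) 2) (hUm : MeasurableSet U) (hU : volume U ≠ ⊤)

include hu hs hq hUm hU

theorem exists_ae_le : ∃ M : ℝ, ∀ᵐ x, u x ≤ M := by
  have hV := unitBallVolume_pos N
  have hδ := deGiorgiFactor_pos N (2 * s)
  have hs0 := hs.1
  set I := ∫ x, u x ^ 2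
  set ρ : ℝ := (unitBallVolume N * deGiorgiFactor N (2 * s) / 320) ^ (2 * s)⁻¹
  have hρ0 : 0 < ρ := by positivity
  have hρs : ρ ^ (2 * s) = unitBallVolume N * deGiorgiFactor N (2 * s) / 320 :=
    Real.rpow_inv_rpow (by positivity) (by positivity)
  set K : ℝ := max 1 (8 * I / (unitBallVolume N * ρ ^ N))
  have hK1 : 1 ≤ K := le_max_left _ _
  have hIK : 8 * I ≤ K * (unitBallVolume N * ρ ^ N) :=
    (div_le_iff₀ (by positivity)).1 (le_max_right _ _)
  have hstart : 8 * excess u (fun _ => 1) K ≤ K ^ 2 * (unitBallVolume N * ρ ^ N) := by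
    calc 8 * excess u (fun _ => 1) K ≤ 8 * I := by
          gcongr
          exact excess_le_integral_sq hu.measurable hu.nonneg (hu.integrable_sq hs hU)
            measurable_const (fun _ => zero_le_one) (by positivity)
      _ ≤ K * (unitBallVolume N * ρ ^ N) := hIK
      _ ≤ K ^ 2 * (unitBallVolume N * ρ ^ N) := by
          gcongr
          exact le_self_pow₀ hK1 two_ne_zero
  exact ⟨2 * K * 1, hu.ae_le_of_excess_le hs hq hUm hU contDiff_const (fun _ => le_rfl)
    (by positivity) (Real.rpow_le_one_of_one_le_of_nonpos hK1 (by linarith [hq.2]))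
    (fun x => by simp [fracGradSq]) hρ0 hstart (by rw [hρs]; linarith)⟩

theorem mul_excess_le {H : EuclideanSpace ℝ (Fin N) → ℝ} (hH : ContDiff ℝ ∞ H)
    (hH1 : ∀ x, 1 ≤ H x) {x₀ : EuclideanSpace ℝ (Fin N)} {R : ℝ} (hR : 0 < R)
    (hH4 : ∀ x ∉ ball x₀ R, H x = 4) {K μ l : ℝ} (hK : 0 < K) (hμ : K ^ (q - 2) ≤ μ)
    (hgrad : ∀ x, fracGradSq s H x ≤ ENNReal.ofReal μ) (hl0 : 0 ≤ l)
    (hl : ENNReal.ofReal l ≤ firstEigenvalue U s 2) (hb : ∀ᵐ x, u x ≤ 4 * K) :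
    l * excess u H K ≤ 320 * μ * (K ^ 2 * (unitBallVolume N * R ^ N)) := by
  have hμ0 : 0 < μ := (Real.rpow_pos_of_pos hK _).trans_le hμ
  have hKH (x) : K ≤ K * H x := le_mul_of_one_le_right hK.le (hH1 x)
  have hKgrad (x) : fracGradSq s (fun x => K * H x) x ≤ ENNReal.ofReal (K ^ 2 * μ) := by
    rw [fracGradSq_const_mul, ENNReal.ofReal_mul (sq_nonneg K)]
    exact mul_le_mul_right (hgrad x) _
  have hzD : MemD U s fun x => max (u x - K * H x) 0 :=
    hu.memD.posPart_sub hs hUm hU (contDiff_const.mul hH) (fun x => hK.le.trans (hKH x))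
      ENNReal.ofReal_ne_top hKgrad
  have hset : ∫ x in {x | K * H x < u x}, u x ^ 2 ≤ (4 * K) ^ 2 * (unitBallVolume N * R ^ N) := by
    have hsub : {x | K * H x < u x} ≤ᵐ[volume] ball x₀ R := by
      filter_upwards [hb] with x hx (hxu : K * H x < u x)
      by_contra hxR
      rw [hH4 x hxR] at hxu
      linarith
    have hu2 := hu.integrable_sq hs hU
    calc ∫ x in {x | K * H x < u x}, u x ^ 2 ≤ ∫ x in ball x₀ R, u x ^ 2 :=
          setIntegral_mono_set hu2.integrableOn (ae_of_all _ fun x => sq_nonneg _) hsub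
      _ ≤ ∫ _ in ball x₀ R, (4 * K) ^ 2 := by
          refine setIntegral_mono_ae hu2.integrableOn
            (integrableOn_const measure_ball_lt_top.ne) ?_
          filter_upwards [hb] with x hx
          exact pow_le_pow_left₀ (hu.nonneg x) hx 2
      _ = (4 * K) ^ 2 * (unitBallVolume N * R ^ N) := by
          rw [setIntegral_const, volumeReal_ball _ hR, smul_eq_mul, mul_comm]
  calc l * excess u H K ≤ 2 * (energy s fun x => max (u x - K * H x) 0).toReal :=
        hzD.mul_integral_sq_le (hzD.energy_lt_top hs).ne hl0 hl
    _ ≤ 2 * (10 * μ * ((4 * K) ^ 2 * (unitBallVolume N * R ^ N))) := by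
        gcongr
        refine (hu.toReal_energy_posPart_sub_le hs hq hUm hU (contDiff_const.mul hH) hK hKH hμ
          hKgrad).trans ?_
        gcongr
    _ = 320 * μ * (K ^ 2 * (unitBallVolume N * R ^ N)) := by ring

end IsBorelDensity

theorem exists_ae_le_half_of_le_firstEigenvalue [NeZero N] (hs : s ∈ Set.Ioo (0 : ℝ) 1) :
    ∃ C : ℝ, 0 < C ∧ ∀ q ∈ Set.Ioo (0 : ℝ) 2, ∀ U : Set (EuclideanSpace ℝ (Fin N)),
      MeasurableSet U → volume U ≠ ⊤ → ∀ u, IsBorelDensity U s q u → ∀ K, 0 < K →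
      ENNReal.ofReal (C * K ^ (q - 2)) ≤ firstEigenvalue U s 2 → (∀ᵐ x, u x ≤ 4 * K) →
      ∀ᵐ x, u x ≤ 2 * K := by
  obtain ⟨c, hc, hcutoff⟩ := exists_cutoff (N := N) hs
  have hV := unitBallVolume_pos N
  have hδ := deGiorgiFactor_pos N (2 * s)
  have hs0 := hs.1
  set κ : ℝ := (unitBallVolume N * deGiorgiFactor N (2 * s) / (320 * c)) ^ (2 * s)⁻¹
  have hκ0 : 0 < κ := by positivity
  have hκs : κ ^ (2 * s) = unitBallVolume N * deGiorgiFactor N (2 * s) / (320 * c) :=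
    Real.rpow_inv_rpow (by positivity) (by positivity)
  refine ⟨2560 / κ ^ N, by positivity, fun q hq U hUm hU u hu K hK hl hb => ?_⟩
  set μ := K ^ (q - 2)
  have hμ0 : 0 < μ := by positivity
  set R : ℝ := (c / μ) ^ (2 * s)⁻¹
  have hR0 : 0 < R := by positivity
  have hRs : R ^ (2 * s) = c / μ := Real.rpow_inv_rpow (by positivity) (by positivity)
  refine ae_of_forall_ae_mem_ball (half_pos hR0) fun x₀ => ?_
  obtain ⟨H, hH, hH1, hHin, hHout, hgrad⟩ := hcutoff R hR0 x₀
  have hgradμ (x) : fracGradSq s H x ≤ ENNReal.ofReal μ := by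
    refine (hgrad x).trans_eq ?_
    rw [Real.rpow_neg hR0.le, hRs, inv_div, mul_div_cancel₀ _ hc.ne']
  have hexcess := hu.mul_excess_le hs hq hUm hU hH hH1 hR0 hHout hK le_rfl hgradμ (by positivity)
    hl hb
  have hstart : 8 * excess u H K ≤ K ^ 2 * (unitBallVolume N * (κ * R) ^ N) := by
    refine le_of_mul_le_mul_left ?_ (show 0 < 320 * μ / κ ^ N by positivity)
    calc 320 * μ / κ ^ N * (8 * excess u H K) = 2560 / κ ^ N * μ * excess u H K := by ring
      _ ≤ 320 * μ * (K ^ 2 * (unitBallVolume N * R ^ N)) := hexcess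
      _ = 320 * μ / κ ^ N * (K ^ 2 * (unitBallVolume N * (κ * R) ^ N)) := by
        rw [mul_pow]
        field_simp
  have hsmall : 320 * μ * (κ * R) ^ (2 * s) ≤ unitBallVolume N * deGiorgiFactor N (2 * s) := by
    rw [Real.mul_rpow hκ0.le hR0.le, hκs, hRs]
    field_simp
    exact le_rfl
  filter_upwards [hu.ae_le_of_excess_le hs hq hUm hU hH hH1 hK le_rfl hgradμ (by positivity) hstart
    hsmall] with x hx hxR
  rwa [hHin x hxR, mul_one] at hx

theorem mul_div_four_rpow_le {C m : ℝ} (hC : 0 ≤ C) (hm : 0 < m) (hq : 0 ≤ q) :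
    C * (m / 4) ^ (q - 2) ≤ 16 * C / m ^ (2 - q) := by
  rw [← neg_sub 2 q, Real.rpow_neg (by positivity), Real.div_rpow hm.le (by norm_num), inv_div,
    ← mul_div_assoc, mul_comm C]
  gcongr
  calc (4 : ℝ) ^ (2 - q) ≤ 4 ^ (2 : ℝ) :=
        Real.rpow_le_rpow_of_exponent_le (by norm_num) (by linarith)
    _ = 16 := by norm_num

theorem exists_eLpNorm_rpow_le [NeZero N] (hs : s ∈ Set.Ioo (0 : ℝ) 1) :
    ∃ C : ℝ≥0, 0 < C ∧ ∀ q ∈ Set.Ioo (0 : ℝ) 2, ∀ U : Set (EuclideanSpace ℝ (Fin N)),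
      MeasurableSet U → volume U ≠ ⊤ → ∀ u, IsBoundedDensity U s q u →
      eLpNorm u ∞ volume ^ (2 - q) ≤ C * (firstEigenvalue U s 2)⁻¹ := by
  obtain ⟨C, hC, hhalf⟩ := exists_ae_le_half_of_le_firstEigenvalue (N := N) hs
  refine ⟨(16 * C).toNNReal, by simpa using hC, fun q hq U hUm hU u₀ hu₀ => ?_⟩
  obtain ⟨u, huu₀, hu⟩ := hu₀.exists_isBorelDensity hUm
  obtain ⟨M, hM⟩ := hu.exists_ae_le hs hq hUm hU
  have hq2 : 0 < 2 - q := sub_pos.2 hq.2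
  rw [eLpNorm_congr_ae huu₀]
  by_contra! hlt
  have hfin : eLpNorm u ∞ volume ≠ ⊤ := by
    refine (eLpNormEssSup_lt_top_of_ae_bound (C := M) ?_).ne
    filter_upwards [hM] with x hx
    rwa [Real.norm_of_nonneg (hu.nonneg x)]
  set m := (eLpNorm u ∞ volume).toReal
  have hm : eLpNorm u ∞ volume = ENNReal.ofReal m := (ENNReal.ofReal_toReal hfin).symm
  have hm0 : 0 < m := by
    refine ENNReal.toReal_pos (fun h0 => ?_) hfin
    rw [h0, ENNReal.zero_rpow_of_pos hq2] at hlt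
    exact not_lt_zero hlt
  rw [hm, ENNReal.ofReal_rpow_of_pos hm0, ← div_eq_mul_inv] at hlt
  have hmle : ∀ᵐ x, u x ≤ 4 * (m / 4) := by
    filter_upwards [ae_le_eLpNormEssSup (f := u) (μ := volume)] with x hx
    rw [← eLpNorm_exponent_top, hm, Real.enorm_of_nonneg (hu.nonneg x),
      ENNReal.ofReal_le_ofReal_iff hm0.le] at hx
    linarith
  have heig : ENNReal.ofReal (C * (m / 4) ^ (q - 2)) ≤ firstEigenvalue U s 2 := by
    refine (ENNReal.ofReal_le_ofReal (mul_div_four_rpow_le hC.le hm0 hq.1.le)).trans ?_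
    have hmq : 0 < m ^ (2 - q) := by positivity
    rw [ENNReal.ofReal_div_of_pos hmq]
    exact ENNReal.div_le_of_le_mul <| (ENNReal.div_le_iff_le_mul (.inr ENNReal.ofReal_ne_top)
      (.inr (ENNReal.ofReal_pos.2 hmq).ne')).1 hlt.le |>.trans_eq (mul_comm _ _)
  have hmhalf : eLpNorm u ∞ volume ≤ ENNReal.ofReal (2 * (m / 4)) := by
    refine eLpNormEssSup_le_of_ae_bound ?_
    filter_upwards [hhalf q hq U hUm hU u hu _ (by positivity) heig hmle] with x hx
    rwa [Real.norm_of_nonneg (hu.nonneg x)]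
  rw [hm, ENNReal.ofReal_le_ofReal_iff (by positivity)] at hmhalf
  linarith

theorem IsLaneEmdenDensity.exists_seq {Ω : Set (EuclideanSpace ℝ (Fin N))} (hΩ : MeasurableSet Ω)
    {w : EuclideanSpace ℝ (Fin N) → ℝ≥0∞} (hw : IsLaneEmdenDensity Ω s q w) :
    ∃ u : ℕ → EuclideanSpace ℝ (Fin N) → ℝ,
      (∀ n : ℕ, IsBorelDensity (Ω ∩ ball 0 ((n : ℝ) + 1)) s q (u n)) ∧
      ∀ᵐ x ∂(volume.restrict Ω), Tendsto (fun n => ENNReal.ofReal (u n x)) atTop (𝓝 (w x)) := by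
  obtain ⟨v, hv, hlim⟩ := hw
  choose u hvu hu using fun n : ℕ =>
    (hv (n + 1) n.cast_add_one_pos).exists_isBorelDensity (hΩ.inter measurableSet_ball)
  refine ⟨u, hu, ?_⟩
  filter_upwards [hlim, ae_restrict_of_ae (ae_all_iff.2 hvu)] with x hx hux
  simp only [← hux]
  exact hx.comp (tendsto_atTop_add_const_right _ 1 tendsto_natCast_atTop_atTop)

theorem volume_inter_ball_ne_top {Ω : Set (EuclideanSpace ℝ (Fin N))} {r : ℝ} :
    volume (Ω ∩ ball 0 r) ≠ ⊤ :=
  measure_ne_top_of_subset Set.inter_subset_right measure_ball_lt_top.ne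

theorem exists_memLp_and_eLpNorm_rpow_le [NeZero N] (hs : s ∈ Set.Ioo (0 : ℝ) 1) :
    ∃ C : ℝ≥0, 0 < C ∧ ∀ q ∈ Set.Ioo (0 : ℝ) 2, ∀ Ω : Set (EuclideanSpace ℝ (Fin N)),
      MeasurableSet Ω → ∀ w, IsLaneEmdenDensity Ω s q w → 0 < firstEigenvalue Ω s 2 →
      MemLp w ∞ (volume.restrict Ω) ∧
        eLpNorm w ∞ (volume.restrict Ω) ^ (2 - q) ≤ C * (firstEigenvalue Ω s 2)⁻¹ := by
  obtain ⟨C, hC, hbound⟩ := exists_eLpNorm_rpow_le (N := N) hs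
  refine ⟨C, hC, fun q hq Ω hΩ w hw hpos => ?_⟩
  obtain ⟨u, hu, hlim⟩ := hw.exists_seq hΩ
  have hq2 : 0 < 2 - q := sub_pos.2 hq.2
  set B := C * (firstEigenvalue Ω s 2)⁻¹
  have hu_le (n) : ∀ᵐ x, ENNReal.ofReal (u n x) ≤ B ^ (2 - q)⁻¹ := by
    have hnorm : eLpNorm (u n) ∞ volume ≤ B ^ (2 - q)⁻¹ := by
      rw [ENNReal.le_rpow_inv_iff hq2]
      refine (hbound q hq _ (hΩ.inter measurableSet_ball) volume_inter_ball_ne_top _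
        (hu n).isBoundedDensity).trans ?_
      exact mul_le_mul_right
        (ENNReal.inv_le_inv.2 (firstEigenvalue_anti Set.inter_subset_left two_ne_zero)) _
    filter_upwards [ae_le_eLpNormEssSup (f := u n) (μ := volume)] with x hx
    rw [← Real.enorm_of_nonneg ((hu n).nonneg x)]
    exact hx.trans hnorm
  have hw_le : eLpNorm w ∞ (volume.restrict Ω) ≤ B ^ (2 - q)⁻¹ := by
    refine eLpNormEssSup_le_of_ae_enorm_bound ?_
    filter_upwards [hlim, ae_restrict_of_ae (ae_all_iff.2 hu_le)] with x hx hux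
    exact le_of_tendsto' hx hux
  have hmeas : AEMeasurable w (volume.restrict Ω) :=
    aemeasurable_of_tendsto_metrizable_ae'
      (fun n => (hu n).measurable.ennreal_ofReal.aemeasurable) hlim
  have hBtop : B ≠ ⊤ := ENNReal.mul_ne_top ENNReal.coe_ne_top (ENNReal.inv_ne_top.2 hpos.ne')
  exact ⟨⟨hmeas.aestronglyMeasurable,
    hw_le.trans_lt (ENNReal.rpow_lt_top_of_nonneg (inv_nonneg.2 hq2.le) hBtop)⟩,
    (ENNReal.le_rpow_inv_iff hq2).1 hw_le⟩

/-! ### Hidden convexity and the lower bound -/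

theorem energy_sqrt_sq_add_sq_le (hu : AEMeasurable u) (hv : AEMeasurable v) :
    energy s (fun x => √(u x ^ 2 + v x ^ 2)) ≤ energy s u + energy s v := by
  have hw : AEMeasurable fun x => √(u x ^ 2 + v x ^ 2) := by fun_prop
  rw [← lintegral_gagliardoMeasure hu, ← lintegral_gagliardoMeasure hv,
    ← lintegral_gagliardoMeasure hw, ← lintegral_add_left'
      ((aemeasurable_sub_gagliardoMeasure hu).pow_const 2).ennreal_ofReal]
  refine lintegral_mono fun p => ?_
  rw [← ENNReal.ofReal_add (sq_nonneg _) (sq_nonneg _)]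
  refine ENNReal.ofReal_le_ofReal ?_
  simpa using sq_sqrt_sub_sqrt_le 0 (u p.1) (u p.2) (v p.1) (v p.2)

namespace IsBorelDensity

theorem lintegral_sq_mul_rpow_le [NeZero N] (hu : IsBorelDensity U s q u)
    (hs : s ∈ Set.Ioo (0 : ℝ) 1) (hq : q ∈ Set.Ioo (0 : ℝ) 2) (hU : volume U ≠ ⊤)
    (hφ : IsTestFunction U φ) :
    ∫⁻ x, ENNReal.ofReal (φ x ^ 2 * √(u x ^ 2 + φ x ^ 2) ^ (q - 2)) ≤ energy s φ := by
  set v : EuclideanSpace ℝ (Fin N) → ℝ := fun x => √(u x ^ 2 + φ x ^ 2) with hv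
  have hvU : Function.support v ⊆ U := by
    intro x hx
    by_contra hxU
    simp [hv, hu.eq_zero hxU, hφ.eq_zero hxU] at hx
  have hvm : Measurable v := by
    have := hu.measurable
    have := hφ.measurable
    fun_prop
  obtain ⟨hint, hmin⟩ := hu.integrable_and_energy_add_integral_le hs hq hU
    (hu.memD.sqrt_sq_add_sq hs hφ) hvm (fun x => Real.sqrt_nonneg _) hvU
  have hq0 := hq.1
  have hle (x) : φ x ^ 2 * v x ^ (q - 2) ≤ 2 / q * (v x ^ q - u x ^ q) := by
    rcases (Real.sqrt_nonneg (u x ^ 2 + φ x ^ 2)).eq_or_lt' with hvx | hvx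
    · have hsum := (Real.sqrt_eq_zero (by positivity)).1 hvx
      have hux : u x = 0 := by nlinarith [sq_nonneg (u x), sq_nonneg (φ x)]
      have hφx : φ x = 0 := by nlinarith [sq_nonneg (u x), sq_nonneg (φ x)]
      simp [hv, hux, hφx]
    · have hconcave := rpow_sub_rpow_le_mul_sq_sub_sq hq0.le hq.2.le hvx (hu.nonneg x)
      rw [Real.sq_sqrt (by positivity)] at hconcave
      rw [div_mul_eq_mul_div, le_div_iff₀ hq0]
      change _ ≤ 2 * (√(u x ^ 2 + φ x ^ 2) ^ q - u x ^ q)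
      linear_combination 2 * hconcave
  have hEφ := (hφ.energy_lt_top hs).ne
  have hEu := (hu.memD.energy_lt_top hs).ne
  have hEv : (energy s v).toReal ≤ (energy s u).toReal + (energy s φ).toReal := by
    rw [← ENNReal.toReal_add hEu hEφ]
    exact ENNReal.toReal_mono (by finiteness) (energy_sqrt_sq_add_sq_le
      hu.measurable.aemeasurable hφ.measurable.aemeasurable)
  calc ∫⁻ x, ENNReal.ofReal (φ x ^ 2 * v x ^ (q - 2))
      ≤ ∫⁻ x, ENNReal.ofReal (2 / q * (v x ^ q - u x ^ q)) :=
        lintegral_mono fun x => ENNReal.ofReal_le_ofReal (hle x)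
    _ = ENNReal.ofReal (2 / q * ∫ x, (v x ^ q - u x ^ q)) := by
        rw [← integral_const_mul, ofReal_integral_eq_lintegral_ofReal (hint.const_mul _)]
        exact ae_of_all _ fun x => le_trans (by positivity) (hle x)
    _ ≤ ENNReal.ofReal (energy s φ).toReal := ENNReal.ofReal_le_ofReal (by linarith)
    _ = energy s φ := ENNReal.ofReal_toReal hEφ

theorem lintegral_sq_mul_rpow_scaled_le [NeZero N] (hu : IsBorelDensity U s q u)
    (hs : s ∈ Set.Ioo (0 : ℝ) 1) (hq : q ∈ Set.Ioo (0 : ℝ) 2) (hU : volume U ≠ ⊤)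
    (hφ : IsTestFunction U φ) {ε : ℝ} (hε : 0 < ε) :
    ∫⁻ x, ENNReal.ofReal (φ x ^ 2 * √(u x ^ 2 + (ε * φ x) ^ 2) ^ (q - 2)) ≤ energy s φ := by
  have hle := hu.lintegral_sq_mul_rpow_le hs hq hU (hφ.const_mul ε)
  have hε2 : ENNReal.ofReal (ε ^ 2) ≠ 0 := by simpa using hε.ne'
  rw [energy_const_mul] at hle
  simp only [mul_pow ε (φ _), mul_assoc (ε ^ 2), ENNReal.ofReal_mul (sq_nonneg ε)] at hle
  rw [lintegral_const_mul' _ _ ENNReal.ofReal_ne_top,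
    ENNReal.mul_le_mul_iff_right hε2 ENNReal.ofReal_ne_top] at hle
  simpa only [mul_pow] using hle

end IsBorelDensity

theorem IsTestFunction.exists_forall_ge_inter_ball (hφ : IsTestFunction U φ) :
    ∃ R : ℝ, ∀ r ≥ R, IsTestFunction (U ∩ ball 0 r) φ := by
  obtain ⟨R, hR⟩ := hφ.isCompact_tsupport.isBounded.subset_ball 0
  exact ⟨R, fun r hr => ⟨hφ.1, hφ.2.1, Set.subset_inter hφ.2.2 (hR.trans (ball_subset_ball hr))⟩⟩

theorem tendsto_ofReal_sq_mul_sqrt_rpow {a ε : ℕ → ℝ} {c : ℝ} {b : ℝ≥0∞} (p : ℝ)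
    (ha : ∀ n, 0 ≤ a n) (hε : Tendsto ε atTop (𝓝 0)) (hε0 : ∀ n, 0 < ε n)
    (hab : Tendsto (fun n => ENNReal.ofReal (a n)) atTop (𝓝 b)) :
    Tendsto (fun n => ENNReal.ofReal (c ^ 2 * √(a n ^ 2 + (ε n * c) ^ 2) ^ p)) atTop
      (𝓝 (ENNReal.ofReal (c ^ 2) * b ^ p)) := by
  rcases eq_or_ne c 0 with rfl | hc
  · simp
  have hpos (n) : 0 < √(a n ^ 2 + (ε n * c) ^ 2) := by
    have := hε0 n
    positivity
  have herr : Tendsto (fun n => ENNReal.ofReal (a n) + ENNReal.ofReal |ε n * c|) atTop (𝓝 b) := by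
    simpa using hab.add (ENNReal.tendsto_ofReal (hε.mul_const c).abs)
  have hsqrt : Tendsto (fun n => ENNReal.ofReal √(a n ^ 2 + (ε n * c) ^ 2)) atTop (𝓝 b) := by
    refine tendsto_of_tendsto_of_tendsto_of_le_of_le hab herr
      (fun n => ENNReal.ofReal_le_ofReal ?_) (fun n => ?_)
    · exact Real.le_sqrt_of_sq_le (le_add_of_nonneg_right (sq_nonneg _))
    · rw [← ENNReal.ofReal_add (ha n) (abs_nonneg _)]
      refine ENNReal.ofReal_le_ofReal (Real.sqrt_le_iff.2 ⟨by have := ha n; positivity, ?_⟩)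
      nlinarith [sq_abs (ε n * c), mul_nonneg (ha n) (abs_nonneg (ε n * c))]
  simp only [ENNReal.ofReal_mul (sq_nonneg c), ← ENNReal.ofReal_rpow_of_pos (hpos _)]
  exact ENNReal.Tendsto.const_mul (ENNReal.continuous_rpow_const.continuousAt.tendsto.comp hsqrt)
    (.inr ENNReal.ofReal_ne_top)

namespace IsLaneEmdenDensity

variable {Ω : Set (EuclideanSpace ℝ (Fin N))} {w : EuclideanSpace ℝ (Fin N) → ℝ≥0∞}

theorem lintegral_sq_mul_rpow_le [NeZero N] (hw : IsLaneEmdenDensity Ω s q w)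
    (hs : s ∈ Set.Ioo (0 : ℝ) 1) (hq : q ∈ Set.Ioo (0 : ℝ) 2) (hΩ : MeasurableSet Ω)
    (hφ : IsTestFunction Ω φ) :
    ∫⁻ x in Ω, ENNReal.ofReal (φ x ^ 2) * w x ^ (q - 2) ≤ energy s φ := by
  obtain ⟨u, hu, hlim⟩ := hw.exists_seq hΩ
  obtain ⟨R, hφR⟩ := hφ.exists_forall_ge_inter_ball
  set ε : ℕ → ℝ := fun n => 1 / ((n : ℝ) + 1)
  have hε0 (n) : 0 < ε n := Nat.one_div_pos_of_nat
  set F : ℕ → EuclideanSpace ℝ (Fin N) → ℝ≥0∞ := fun n x =>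
    ENNReal.ofReal (φ x ^ 2 * √(u n x ^ 2 + (ε n * φ x) ^ 2) ^ (q - 2))
  have hF (n) : Measurable (F n) := by
    have := hφ.measurable
    have := (hu n).measurable
    fun_prop
  have hF_lim : ∀ᵐ x ∂(volume.restrict Ω),
      ENNReal.ofReal (φ x ^ 2) * w x ^ (q - 2) = liminf (fun n => F n x) atTop := by
    filter_upwards [hlim] with x hx
    exact (tendsto_ofReal_sq_mul_sqrt_rpow (q - 2) (fun n => (hu n).nonneg x)
      tendsto_one_div_add_atTop_nhds_zero_nat hε0 hx).liminf_eq.symm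
  have hF_le : ∀ᶠ n : ℕ in atTop, ∫⁻ x in Ω, F n x ≤ energy s φ := by
    filter_upwards [eventually_ge_atTop ⌈R⌉₊] with n hn
    exact (setLIntegral_le_lintegral _ _).trans <| (hu n).lintegral_sq_mul_rpow_scaled_le hs hq
      volume_inter_ball_ne_top (hφR _ ((Nat.le_of_ceil_le hn).trans (by simp))) (hε0 n)
  calc ∫⁻ x in Ω, ENNReal.ofReal (φ x ^ 2) * w x ^ (q - 2)
      = ∫⁻ x in Ω, liminf (fun n => F n x) atTop := lintegral_congr_ae hF_lim
    _ ≤ liminf (fun n => ∫⁻ x in Ω, F n x) atTop := lintegral_liminf_le hF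
    _ ≤ energy s φ := liminf_le_of_le (by isBoundedDefault) fun b hb =>
        (hb.and hF_le).exists.elim fun _ h => h.1.trans h.2

theorem eLpNorm_rpow_le_firstEigenvalue [NeZero N] (hw : IsLaneEmdenDensity Ω s q w)
    (hs : s ∈ Set.Ioo (0 : ℝ) 1) (hq : q ∈ Set.Ioo (0 : ℝ) 2) (hΩ : MeasurableSet Ω) :
    eLpNorm w ∞ (volume.restrict Ω) ^ (q - 2) ≤ firstEigenvalue Ω s 2 := by
  refine le_iInf₂ fun φ hφ => le_iInf fun hφ1 => ?_
  have hmass : ∫⁻ x in Ω, ENNReal.ofReal (φ x ^ 2) = 1 := by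
    simp only [Real.rpow_two, sq_abs] at hφ1
    rw [← ofReal_integral_eq_lintegral_ofReal hφ.integrable_sq.integrableOn
      (ae_of_all _ fun x => sq_nonneg _), hφ1, ENNReal.ofReal_one]
  set W := eLpNorm w ∞ (volume.restrict Ω)
  have hle : ∀ᵐ x ∂(volume.restrict Ω), W ^ (q - 2) ≤ w x ^ (q - 2) := by
    filter_upwards [ae_le_eLpNormEssSup (f := w) (μ := volume.restrict Ω)] with x hx
    rw [← neg_sub, ENNReal.rpow_neg, ENNReal.rpow_neg]
    exact ENNReal.inv_le_inv.2 (ENNReal.rpow_le_rpow hx (sub_nonneg.2 hq.2.le))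
  calc W ^ (q - 2) = ∫⁻ x in Ω, ENNReal.ofReal (φ x ^ 2) * W ^ (q - 2) := by
        rw [lintegral_mul_const _ (by have := hφ.measurable; fun_prop), hmass, one_mul]
    _ ≤ ∫⁻ x in Ω, ENNReal.ofReal (φ x ^ 2) * w x ^ (q - 2) := by
        refine lintegral_mono_ae ?_
        filter_upwards [hle] with x hx
        gcongr
    _ ≤ energy s φ := hw.lintegral_sq_mul_rpow_le hs hq hΩ hφ

end IsLaneEmdenDensity

end FracLaneEmden

theorem mainTheorem7_general (N : ℕ) (hN : 1 ≤ N) (s : ℝ) (hs : s ∈ Set.Ioo (0 : ℝ) 1) :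
    (∃ C : ℝ≥0, 0 < C ∧
      ∀ q ∈ Set.Ioo (0 : ℝ) 2, ∀ Ω : Set (EuclideanSpace ℝ (Fin N)), MeasurableSet Ω →
      ∀ w : EuclideanSpace ℝ (Fin N) → ℝ≥0∞, FracLaneEmden.IsLaneEmdenDensity Ω s q w →
        0 < FracLaneEmden.firstEigenvalue Ω s 2 →
          MemLp w ∞ (volume.restrict Ω) ∧
          eLpNorm w ∞ (volume.restrict Ω) ^ (2 - q) ≤
            (C : ℝ≥0∞) * (FracLaneEmden.firstEigenvalue Ω s 2)⁻¹) ∧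
    (∀ q ∈ Set.Ioo (0 : ℝ) 2, ∀ Ω : Set (EuclideanSpace ℝ (Fin N)), MeasurableSet Ω →
      ∀ w : EuclideanSpace ℝ (Fin N) → ℝ≥0∞, FracLaneEmden.IsLaneEmdenDensity Ω s q w →
        eLpNorm w ∞ (volume.restrict Ω) ^ (q - 2) ≤ FracLaneEmden.firstEigenvalue Ω s 2) := by
  have : NeZero N := ⟨Nat.one_le_iff_ne_zero.1 hN⟩
  exact ⟨FracLaneEmden.exists_memLp_and_eLpNorm_rpow_le hs,
    fun q hq Ω hΩ w hw => hw.eLpNorm_rpow_le_firstEigenvalue hs hq hΩ⟩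

theorem mainTheorem7 (N : ℕ) (hN : 1 ≤ N) (s : ℝ) (hs : s ∈ Set.Ioo (0 : ℝ) 1)
    (q : ℝ) (hq : q ∈ Set.Ioo (1 : ℝ) 2) :
    (∃ C : ℝ≥0, 0 < C ∧
      ∀ Ω : Set (EuclideanSpace ℝ (Fin N)), IsOpen Ω →
      ∀ w : EuclideanSpace ℝ (Fin N) → ℝ≥0∞, FracLaneEmden.IsLaneEmdenDensity Ω s q w →
        0 < FracLaneEmden.firstEigenvalue Ω s 2 →
          MemLp w ∞ (volume.restrict Ω) ∧
          eLpNorm w ∞ (volume.restrict Ω) ^ (2 - q) ≤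
            (C : ℝ≥0∞) * (FracLaneEmden.firstEigenvalue Ω s 2)⁻¹) ∧
    (∀ Ω : Set (EuclideanSpace ℝ (Fin N)), IsOpen Ω →
      ∀ w : EuclideanSpace ℝ (Fin N) → ℝ≥0∞, FracLaneEmden.IsLaneEmdenDensity Ω s q w →
        MemLp w ∞ (volume.restrict Ω) →
          eLpNorm w ∞ (volume.restrict Ω) ^ (q - 2) ≤ FracLaneEmden.firstEigenvalue Ω s 2) := by
  have hq' : q ∈ Set.Ioo (0 : ℝ) 2 := ⟨one_pos.trans hq.1, hq.2⟩
  obtain ⟨⟨C, hC, hbound⟩, hconverse⟩ := mainTheorem7_general N hN s hs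
  exact ⟨⟨C, hC, fun Ω hΩ => hbound q hq' Ω hΩ.measurableSet⟩,
    fun Ω hΩ w hw _ => hconverse q hq' Ω hΩ.measurableSet w hw⟩
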